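/- Let $\mathsf X,\mathsf Z$ be random variables with values in finite sets $\mathcal X,\mathcal Z$ and joint pmf $p_{\mathsf X,\mathsf Z}$; all logarithms are natural. A triple $(\mu,R_1,R_2)\in\mathbb R^3$ is *achievable* if for some integer $n\ge 1$ there are finite sets $\mathcal M_1,\mathcal M_2$ with $\log|\mathcal M_k|\le nR_k$ ($k=1,2$) and functions $f:\mathcal X^n\to\mathcal M_1$, $g:\mathcal Z^n\to\mathcal M_2$ such that $\frac1n I\big(f(\mathsf X^n);g(\mathsf Z^n)\big)\ge\mu$, where $(\mathsf X^n,\mathsf Z^n)$ consists of $n$ i.i.d. copies of $(\mathsf X,\mathsf Z)$. Let $\mathcal R$ be the set of achievable triples and $\overline{\mathcal R}$ its closure in $\mathbb R^3$. Let $$\mathcal R_{\rm i}=\big\{(\mu,R_1,R_2)\in\mathbb R^3:\ R_1\ge I(\mathsf U;\mathsf X),\ R_2\ge I(\mathsf V;\mathsf Z),\ \mu\le I(\mathsf U;\mathsf V)\big\},$$ where $\mathsf U,\mathsf V$ range over all random variables with values in finite sets $\mathcal U,\mathcal V$ such that $\mathsf U - \mathsf X - \mathsf Z - \mathsf V$ is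 a Markov chain, and let $\mathcal S_{\rm i}$ be defined in the same way with the additional requirement $|\mathcal U|\le|\mathcal X|$ and $|\mathcal V|\le|\mathcal Z|$. Then $$\mathrm{conv}(\mathcal S_{\rm i})=\mathrm{conv}(\mathcal R_{\rm i})\subseteq\overline{\mathcal R}.$$ Moreover, $$\mathrm{conv}(\mathcal S_{\rm i})=\big\{(\mu,R_1,R_2)\in\mathbb R^3:\ R_1\ge I(\mathsf U;\mathsf X\mid\mathsf Q),\ R_2\ge I(\mathsf V;\mathsf Z\mid\mathsf Q),\ \mu\le I(\mathsf U;\mathsf V\mid\mathsf Q)\big\},$$ where $\mathsf U,\mathsf V,\mathsf Q$ range over all random variables with values in finite sets $\mathcal U,\mathcal V,\mathcal Q$ such that $p_{\mathsf X,\mathsf Z,\mathsf U,\mathsf V,\mathsf Q}=p_{\mathsf X,\mathsf Z}\,p_{\mathsf U|\mathsf X,\mathsf Q}\,p_{\mathsf V|\mathsf Z,\mathsf Q}\,p_{\mathsf Q}$, $|\mathcal U|\le|\mathcal X|$, $|\mathcal V|\le|\mathcal Z|$ and $|\mathcal Q|\le 3$. -/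

import Mathlib

noncomputable section

namespace Biclustering

open Classical in
/-- The probability mass function of the random variable `A : Ω → α` on the finite probability
space with pmf `P`, i.e. `law P A a` is the probability that `A = a`. -/
def law {Ω α : Type*} [Fintype Ω] (P : Ω → ℝ) (A : Ω → α) (a : α) : ℝ :=
  ∑ ω, if A ω = a then P ω else 0

/-- The mutual information `I(A; B)` in nats. If `A = a, B = b` has probability zero then the
corresponding term is `0`; otherwise no denominator vanishes. -/
def mutInfo {Ω α β : Type*} [Fintype Ω] [Fintype α] [Fintype β]
    (P : Ω → ℝ) (A : Ω → α) (B : Ω → β) : ℝ :=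
  ∑ a, ∑ b, law P (fun ω => (A ω, B ω)) (a, b) *
    Real.log (law P (fun ω => (A ω, B ω)) (a, b) / (law P A a * law P B b))

/-- The conditional mutual information `I(A; B | C)` in nats, i.e. the expectation of
`log (p(a, b | c) / (p(a | c) p(b | c)))`, where the fraction is written in terms of joint
probabilities as `p(a, b, c) p(c) / (p(a, c) p(b, c))`. -/
def condMutInfo {Ω α β γ : Type*} [Fintype Ω] [Fintype α] [Fintype β] [Fintype γ]
    (P : Ω → ℝ) (A : Ω → α) (B : Ω → β) (C : Ω → γ) : ℝ :=
  ∑ a, ∑ b, ∑ c, law P (fun ω => (A ω, B ω, C ω)) (a, b, c) *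
    Real.log (law P (fun ω => (A ω, B ω, C ω)) (a, b, c) * law P C c /
      (law P (fun ω => (A ω, C ω)) (a, c) * law P (fun ω => (B ω, C ω)) (b, c)))

/-- `A - B - C` is a Markov chain: `A` and `C` are conditionally independent given `B`. -/
def IsMarkov {Ω α β γ : Type*} [Fintype Ω]
    (P : Ω → ℝ) (A : Ω → α) (B : Ω → β) (C : Ω → γ) : Prop :=
  ∀ a b c, law P (fun ω => (A ω, B ω, C ω)) (a, b, c) * law P B b =
    law P (fun ω => (A ω, B ω)) (a, b) * law P (fun ω => (B ω, C ω)) (b, c)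

/-- `A - B - C - D` is a Markov chain: at each interior variable, the past and the future
are conditionally independent given the present. -/
def IsMarkov₄ {Ω α β γ δ : Type*} [Fintype Ω]
    (P : Ω → ℝ) (A : Ω → α) (B : Ω → β) (C : Ω → γ) (D : Ω → δ) : Prop :=
  IsMarkov P A B (fun ω => (C ω, D ω)) ∧ IsMarkov P (fun ω => (A ω, B ω)) C D

/-- The pmf of `n` i.i.d. copies of a random variable with pmf `p`. -/
def iid {S : Type*} (p : S → ℝ) (n : ℕ) (ω : Fin n → S) : ℝ :=
  ∏ i, p (ω i)

/-- The set of achievable triples `(μ, R₁, R₂)`: for some block length `n ≥ 1` there are encoders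
`f : Xⁿ → M₁` and `g : Zⁿ → M₂` with `log |M₁| ≤ n R₁`, `log |M₂| ≤ n R₂` and
`I(f(Xⁿ); g(Zⁿ)) / n ≥ μ`. -/
def achievable {X Z : Type*} [Fintype X] [Fintype Z] (p : X × Z → ℝ) : Set (ℝ × ℝ × ℝ) :=
  {t | ∃ n : ℕ, 0 < n ∧ ∃ (m₁ m₂ : ℕ) (f : (Fin n → X) → Fin m₁) (g : (Fin n → Z) → Fin m₂),
    Real.log m₁ ≤ n * t.2.1 ∧ Real.log m₂ ≤ n * t.2.2 ∧
    t.1 ≤ (1 / (n : ℝ)) *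
      mutInfo (iid p n) (fun ω => f (fun i => (ω i).1)) (fun ω => g (fun i => (ω i).2))}

/-- The triples `(μ, R₁, R₂)` with `R₁ ≥ I(U; X)`, `R₂ ≥ I(V; Z)`, `μ ≤ I(U; V)` for some
auxiliary variables with values in the alphabets `U` and `V` such that `(X, Z)` has pmf `p` and
`U - X - Z - V` is a Markov chain. Here `P` is the joint pmf of `(U, X, Z, V)`. -/
def innerWith {X Z : Type*} [Fintype X] [Fintype Z] (p : X × Z → ℝ)
    (U V : Type) [Fintype U] [Fintype V] : Set (ℝ × ℝ × ℝ) :=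
  {t | ∃ P : U × X × Z × V → ℝ, P ∈ stdSimplex ℝ (U × X × Z × V) ∧
    law P (fun ω => (ω.2.1, ω.2.2.1)) = p ∧
    IsMarkov₄ P (fun ω => ω.1) (fun ω => ω.2.1) (fun ω => ω.2.2.1) (fun ω => ω.2.2.2) ∧
    mutInfo P (fun ω => ω.1) (fun ω => ω.2.1) ≤ t.2.1 ∧
    mutInfo P (fun ω => ω.2.2.2) (fun ω => ω.2.2.1) ≤ t.2.2 ∧
    t.1 ≤ mutInfo P (fun ω => ω.1) (fun ω => ω.2.2.2)}

/-- The inner region with arbitrary finite auxiliary alphabets. -/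
def innerRegion {X Z : Type*} [Fintype X] [Fintype Z] (p : X × Z → ℝ) : Set (ℝ × ℝ × ℝ) :=
  {t | ∃ k l : ℕ, t ∈ innerWith p (Fin k) (Fin l)}

/-- The inner region with the cardinality bounds `|U| ≤ |X|` and `|V| ≤ |Z|`. -/
def innerRegionBounded {X Z : Type*} [Fintype X] [Fintype Z] (p : X × Z → ℝ) :
    Set (ℝ × ℝ × ℝ) :=
  {t | ∃ k l : ℕ, k ≤ Fintype.card X ∧ l ≤ Fintype.card Z ∧ t ∈ innerWith p (Fin k) (Fin l)}

/-- The triples `(μ, R₁, R₂)` with `R₁ ≥ I(U; X | Q)`, `R₂ ≥ I(V; Z | Q)`, `μ ≤ I(U; V | Q)` for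
some joint pmf `P` of `(X, Z, U, V, Q)` of the form
`p(x, z) p(u | x, q) p(v | z, q) p(q)`. Here `a`, `b` are the conditional pmfs `p(u | x, q)` and
`p(v | z, q)`, and `r` is the pmf of the time-sharing variable `Q`. -/
def timeSharingWith {X Z : Type*} [Fintype X] [Fintype Z] (p : X × Z → ℝ)
    (U V Q : Type) [Fintype U] [Fintype V] [Fintype Q] : Set (ℝ × ℝ × ℝ) :=
  {t | ∃ (a : X → Q → U → ℝ) (b : Z → Q → V → ℝ) (r : Q → ℝ) (P : X × Z × U × V × Q → ℝ),
    (∀ x q, a x q ∈ stdSimplex ℝ U) ∧ (∀ z q, b z q ∈ stdSimplex ℝ V) ∧ r ∈ stdSimplex ℝ Q ∧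
    (∀ x z u v q, P (x, z, u, v, q) = p (x, z) * a x q u * b z q v * r q) ∧
    condMutInfo P (fun ω => ω.2.2.1) (fun ω => ω.1) (fun ω => ω.2.2.2.2) ≤ t.2.1 ∧
    condMutInfo P (fun ω => ω.2.2.2.1) (fun ω => ω.2.1) (fun ω => ω.2.2.2.2) ≤ t.2.2 ∧
    t.1 ≤ condMutInfo P (fun ω => ω.2.2.1) (fun ω => ω.2.2.2.1) (fun ω => ω.2.2.2.2)}

/-- The time-sharing region with `|U| ≤ |X|`, `|V| ≤ |Z|` and `|Q| ≤ 3`. -/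
def timeSharingRegion {X Z : Type*} [Fintype X] [Fintype Z] (p : X × Z → ℝ) :
    Set (ℝ × ℝ × ℝ) :=
  {t | ∃ k l m : ℕ, k ≤ Fintype.card X ∧ l ≤ Fintype.card Z ∧ m ≤ 3 ∧
    t ∈ timeSharingWith p (Fin k) (Fin l) (Fin m)}

end Biclustering

end

/-! Achievability needs no joint typicality of the two codewords: it applies a one-sided coding
result twice. In `exists_encoder`, a chain U - X - Y lets a code of rate about I(U;X) retain almost
n I(U;Y) nats about Yⁿ. The code comes from a covering lemma (`exists_covering`): all but O(1/n) of
the source mass has a codeword c with a good score, the score being the conditional mean given Xⁿ of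
log ρ(c, Yⁿ) for a near-optimal density ρ. The variational bound `sum_mul_log_le_mutInfo` turns the
expected score into a lower bound on mutual information. The first application, to U - X - V, gives
f with I(f(Xⁿ);Vⁿ) ≈ n I(U;V). Now blocks of length n become letters: Vⁿ - Zⁿ - f(Xⁿ) is again a
chain, and the second application encodes N such blocks of Z while retaining almost N I(Vⁿ;f(Xⁿ))
nats about the N values of f. Concatenating codes in rational proportions makes the closure of the
achievable set convex, hence it contains the convex hull. For the cardinality bounds, fix the
channel Z → V and put a nonnegative weight on each column of the channel X → U. The weighted columns
form a channel under |X| linear constraints; on such weights I(U;X) and I(U;V) are linear and I(V;Z)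
is constant. By `mem_convexHull_small_support` the given weighting is a convex combination of ones
supported on at most |X| letters. Reversing the chain treats V. For time sharing, a conditional
mutual information is the average over q of the unconditional ones. Three values of Q suffice
because only the total mass and the two rates need be preserved; μ may increase. -/

noncomputable section

namespace Biclustering

/-! ### Laws and mutual information on finite probability spaces. -/

section Law

variable {Ω Ω' α β γ δ : Type*} [Fintype Ω] [Fintype Ω'] [Fintype α] [Fintype β]

theorem sum_law_mul (P : Ω → ℝ) (A : Ω → α) (F : α → ℝ) :
    ∑ a, law P A a * F a = ∑ ω, P ω * F (A ω) := by
  classical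
  simp only [law, Finset.sum_mul]
  rw [Finset.sum_comm]
  refine Finset.sum_congr rfl fun ω _ => ?_
  rw [Finset.sum_eq_single (A ω)]
  · simp
  · intro b _ hb
    simp [Ne.symm hb]
  · simp

theorem sum_law (P : Ω → ℝ) (A : Ω → α) : ∑ a, law P A a = ∑ ω, P ω := by
  simpa using sum_law_mul P A fun _ => 1

omit [Fintype α] [Fintype β] in
theorem law_congr (P : Ω → ℝ) {A : Ω → α} {B : Ω → β} {a : α} {b : β}
    (h : ∀ ω, A ω = a ↔ B ω = b) : law P A a = law P B b := by
  classical
  exact Finset.sum_congr rfl fun ω _ => if_congr (h ω) rfl rfl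

omit [Fintype α] in
theorem law_nonneg {P : Ω → ℝ} (hP : ∀ ω, 0 ≤ P ω) (A : Ω → α) (a : α) : 0 ≤ law P A a :=
  Finset.sum_nonneg fun ω _ => by split_ifs <;> simp [hP]

omit [Fintype α] in
theorem le_law {P : Ω → ℝ} (hP : ∀ ω, 0 ≤ P ω) (A : Ω → α) (ω : Ω) : P ω ≤ law P A (A ω) := by
  classical
  have := Finset.single_le_sum (f := fun ω' => if A ω' = A ω then P ω' else 0)
    (fun ω' _ => by split_ifs <;> simp [hP]) (Finset.mem_univ ω)
  simpa [law] using this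

theorem law_law (P : Ω → ℝ) (A : Ω → α) (g : α → γ) :
    law (law P A) g = law P fun ω => g (A ω) := by
  classical
  funext c
  have := sum_law_mul P A fun a => if g a = c then 1 else 0
  simpa [law] using this

theorem law_mem_stdSimplex {P : Ω → ℝ} (hP : P ∈ stdSimplex ℝ Ω) (A : Ω → α) :
    law P A ∈ stdSimplex ℝ α :=
  ⟨law_nonneg hP.1 A, (sum_law P A).trans hP.2⟩

omit [Fintype α] in
theorem sum_law_pair_right (P : Ω → ℝ) (A : Ω → α) (B : Ω → β) (a : α) :
    ∑ b, law P (fun ω => (A ω, B ω)) (a, b) = law P A a := by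
  classical
  simp only [law]
  rw [Finset.sum_comm]
  refine Finset.sum_congr rfl fun ω _ => ?_
  by_cases h : A ω = a <;> simp [h]

omit [Fintype α] [Fintype β] in
theorem law_pair_swap (P : Ω → ℝ) (A : Ω → α) (B : Ω → β) (a : α) (b : β) :
    law P (fun ω => (A ω, B ω)) (a, b) = law P (fun ω => (B ω, A ω)) (b, a) :=
  law_congr P fun ω => by simp only [Prod.mk.injEq, and_comm]

omit [Fintype β] in
theorem sum_law_pair_left (P : Ω → ℝ) (A : Ω → α) (B : Ω → β) (b : β) :
    ∑ a, law P (fun ω => (A ω, B ω)) (a, b) = law P B b := by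
  simp only [law_pair_swap P A B]
  exact sum_law_pair_right P B A b

omit [Fintype α] in
theorem law_pair_le_left {P : Ω → ℝ} (hP : ∀ ω, 0 ≤ P ω) (A : Ω → α) (B : Ω → β) (a : α) (b : β) :
    law P (fun ω => (A ω, B ω)) (a, b) ≤ law P A a := by
  rw [← sum_law_pair_right P A B a]
  exact Finset.single_le_sum (f := fun b => law P (fun ω => (A ω, B ω)) (a, b))
    (fun b _ => law_nonneg hP _ _) (Finset.mem_univ b)

omit [Fintype β] in
theorem law_pair_le_right {P : Ω → ℝ} (hP : ∀ ω, 0 ≤ P ω) (A : Ω → α) (B : Ω → β) (a : α) (b : β) :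
    law P (fun ω => (A ω, B ω)) (a, b) ≤ law P B b := by
  rw [law_pair_swap]
  exact law_pair_le_left hP B A b a

omit [Fintype α] in
theorem law_injective_comp (P : Ω → ℝ) (A : Ω → α) {e : α → γ} (he : Function.Injective e) (a : α) :
    law P (fun ω => e (A ω)) (e a) = law P A a :=
  law_congr P fun _ => he.eq_iff

theorem mutInfo_eq_sum (P : Ω → ℝ) (A : Ω → α) (B : Ω → β) :
    mutInfo P A B = ∑ ω, P ω * Real.log (law P (fun ω => (A ω, B ω)) (A ω, B ω) /
      (law P A (A ω) * law P B (B ω))) := by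
  rw [← sum_law_mul P (fun ω => (A ω, B ω)) fun c => Real.log
    (law P (fun ω => (A ω, B ω)) c / (law P A c.1 * law P B c.2)), Fintype.sum_prod_type]
  rfl

theorem mutInfo_comm (P : Ω → ℝ) (A : Ω → α) (B : Ω → β) : mutInfo P A B = mutInfo P B A := by
  rw [mutInfo_eq_sum, mutInfo_eq_sum]
  refine Finset.sum_congr rfl fun ω _ => ?_
  rw [law_pair_swap, mul_comm (law P A _)]

theorem mutInfo_law [Fintype γ] (P : Ω → ℝ) (C : Ω → γ) (A : γ → α) (B : γ → β) :
    mutInfo (law P C) A B = mutInfo P (fun ω => A (C ω)) (fun ω => B (C ω)) := by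
  simp only [mutInfo, law_law]

theorem mutInfo_injective_comp [Fintype γ] [Fintype δ] (P : Ω → ℝ) (A : Ω → α) (B : Ω → β)
    {e : α → γ} (he : Function.Injective e) {f : β → δ} (hf : Function.Injective f) :
    mutInfo P (fun ω => e (A ω)) (fun ω => f (B ω)) = mutInfo P A B := by
  rw [mutInfo_eq_sum, mutInfo_eq_sum]
  refine Finset.sum_congr rfl fun ω _ => ?_
  rw [law_injective_comp P A he, law_injective_comp P B hf]
  have := law_injective_comp P (fun ω => (A ω, B ω)) (he.prodMap hf) (A ω, B ω)
  simp only [Prod.map_apply] at this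
  rw [this]

omit [Fintype α] in
theorem law_equiv (P : Ω → ℝ) (e : Ω' ≃ Ω) (A : Ω → α) :
    law (fun ω => P (e ω)) (fun ω => A (e ω)) = law P A := by
  classical
  funext a
  exact Equiv.sum_comp e fun ω => if A ω = a then P ω else 0

theorem mutInfo_equiv (P : Ω → ℝ) (e : Ω' ≃ Ω) (A : Ω → α) (B : Ω → β) :
    mutInfo (fun ω => P (e ω)) (fun ω => A (e ω)) (fun ω => B (e ω)) = mutInfo P A B := by
  simp only [mutInfo, law_equiv P e A, law_equiv P e B, law_equiv P e fun ω => (A ω, B ω)]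

/-- The variational lower bound on mutual information. -/
theorem sum_mul_log_le_mutInfo {P : Ω → ℝ} (hP : P ∈ stdSimplex ℝ Ω) (A : Ω → α) (B : Ω → β)
    {ρ : α → β → ℝ} (hρ : ∀ a b, 0 < ρ a b) (hsum : ∀ a, ∑ b, law P B b * ρ a b ≤ 1) :
    ∑ ω, P ω * Real.log (ρ (A ω) (B ω)) ≤ mutInfo P A B := by
  set J := law P fun ω => (A ω, B ω) with hJ
  -- This is log t ≥ 1 - 1/t with t the ratio of the true density to ρ; averaging it leaves 1 minus
  -- the ρ-weighted product mass.
  have key : ∀ ω, P ω * (1 - law P A (A ω) * law P B (B ω) * ρ (A ω) (B ω) / J (A ω, B ω)) ≤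
      P ω * Real.log (J (A ω, B ω) / (law P A (A ω) * law P B (B ω))) -
        P ω * Real.log (ρ (A ω) (B ω)) := by
    intro ω
    rcases (hP.1 ω).eq_or_lt with h | h
    · simp [← h]
    rw [← mul_sub]
    refine mul_le_mul_of_nonneg_left ?_ h.le
    have h1 : 0 < J (A ω, B ω) := h.trans_le (le_law hP.1 (fun ω => (A ω, B ω)) ω)
    have h2 := h.trans_le (le_law hP.1 A ω)
    have h3 := h.trans_le (le_law hP.1 B ω)
    have h4 := hρ (A ω) (B ω)
    rw [← Real.log_div (by positivity) h4.ne']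
    have := Real.one_sub_inv_le_log_of_pos
      (show 0 < J (A ω, B ω) / (law P A (A ω) * law P B (B ω)) / ρ (A ω) (B ω) by positivity)
    refine le_trans (le_of_eq ?_) this
    field_simp
  have hle : ∑ ω, P ω * (law P A (A ω) * law P B (B ω) * ρ (A ω) (B ω) / J (A ω, B ω)) ≤ 1 := by
    rw [← sum_law_mul P (fun ω => (A ω, B ω))
      fun c => law P A c.1 * law P B c.2 * ρ c.1 c.2 / J c, Fintype.sum_prod_type]
    calc _ ≤ ∑ a, ∑ b, law P A a * (law P B b * ρ a b) := by
          refine Finset.sum_le_sum fun a _ => Finset.sum_le_sum fun b _ => ?_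
          have h0 : 0 ≤ law P A a * (law P B b * ρ a b) :=
            mul_nonneg (law_nonneg hP.1 _ _) (mul_nonneg (law_nonneg hP.1 _ _) (hρ a b).le)
          rcases eq_or_ne (J (a, b)) 0 with h | h
          · rw [← hJ, h]
            simpa using h0
          · rw [← hJ, mul_div_cancel₀ _ h, mul_assoc]
      _ = ∑ a, law P A a * ∑ b, law P B b * ρ a b := by simp only [Finset.mul_sum]
      _ ≤ ∑ a, law P A a * 1 := Finset.sum_le_sum fun a _ =>
          mul_le_mul_of_nonneg_left (hsum a) (law_nonneg hP.1 _ _)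
      _ = 1 := by simp only [mul_one, sum_law, hP.2]
  have hs := Finset.sum_le_sum fun ω (_ : ω ∈ Finset.univ) => key ω
  simp only [mul_sub, mul_one, Finset.sum_sub_distrib, hP.2] at hs
  rw [mutInfo_eq_sum]
  linarith

theorem mutInfo_nonneg {P : Ω → ℝ} (hP : P ∈ stdSimplex ℝ Ω) (A : Ω → α) (B : Ω → β) :
    0 ≤ mutInfo P A B := by
  have := sum_mul_log_le_mutInfo hP A B (ρ := fun _ _ => 1) (by simp)
    (by simp [sum_law, hP.2])
  simpa using this

end Law

/-! ### Product measures: additivity of information and variance. -/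

section Product

variable {ι : Type*} [Fintype ι] [DecidableEq ι]

theorem sum_prod_apply {Ω : ι → Type*} [∀ i, Fintype (Ω i)] (P : ∀ i, Ω i → ℝ) :
    ∑ ω : ∀ i, Ω i, ∏ i, P i (ω i) = ∏ i, ∑ s, P i s := by
  classical
  rw [Finset.prod_univ_sum, Fintype.piFinset_univ]

theorem prod_mem_stdSimplex {Ω : ι → Type*} [∀ i, Fintype (Ω i)] {P : ∀ i, Ω i → ℝ}
    (hP : ∀ i, P i ∈ stdSimplex ℝ (Ω i)) :
    (fun ω : ∀ i, Ω i => ∏ i, P i (ω i)) ∈ stdSimplex ℝ (∀ i, Ω i) :=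
  ⟨fun ω => Finset.prod_nonneg fun i _ => (hP i).1 _, by
    rw [sum_prod_apply]; exact Finset.prod_eq_one fun i _ => (hP i).2⟩

theorem sum_prod_mul_apply {Ω : ι → Type*} [∀ i, Fintype (Ω i)] {P : ∀ i, Ω i → ℝ}
    (hP : ∀ i, ∑ s, P i s = 1) (j : ι) (h : Ω j → ℝ) :
    ∑ ω : ∀ i, Ω i, (∏ i, P i (ω i)) * h (ω j) = ∑ s, P j s * h s := by
  -- A function of the single coordinate j is a product with all other factors 1, so the sum
  -- factorizes.
  have h1 : ∀ ω : ∀ i, Ω i, (∏ i, P i (ω i)) * h (ω j) =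
      ∏ i, (P i (ω i) * if hi : i = j then h (hi ▸ ω i) else 1) := by
    intro ω
    rw [Finset.prod_mul_distrib]
    congr 1
    rw [Finset.prod_eq_single j]
    · simp
    · intro b _ hb
      simp [hb]
    · simp
  simp only [h1]
  rw [sum_prod_apply fun i s => P i s * if hi : i = j then h (hi ▸ s) else 1,
    Finset.prod_eq_single j]
  · simp
  · intro b _ hb
    simp [hb, hP]
  · simp

theorem law_pi {Ω α : ι → Type*} [∀ i, Fintype (Ω i)] (P : ∀ i, Ω i → ℝ) (A : ∀ i, Ω i → α i)
    (a : ∀ i, α i) :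
    law (fun ω : ∀ i, Ω i => ∏ i, P i (ω i)) (fun ω i => A i (ω i)) a =
      ∏ i, law (P i) (A i) (a i) := by
  classical
  simp only [law]
  rw [← sum_prod_apply fun i s => if A i s = a i then P i s else 0]
  refine Finset.sum_congr rfl fun ω _ => ?_
  rw [Finset.prod_ite_zero]
  simp [funext_iff]

theorem mutInfo_pi {Ω α β : ι → Type*} [∀ i, Fintype (Ω i)] [∀ i, Fintype (α i)]
    [∀ i, Fintype (β i)] {P : ∀ i, Ω i → ℝ} (hP : ∀ i, P i ∈ stdSimplex ℝ (Ω i))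
    (A : ∀ i, Ω i → α i) (B : ∀ i, Ω i → β i) :
    mutInfo (fun ω : ∀ i, Ω i => ∏ i, P i (ω i)) (fun ω i => A i (ω i)) (fun ω i => B i (ω i)) =
      ∑ i, mutInfo (P i) (A i) (B i) := by
  rw [mutInfo_eq_sum]
  have hpair : ∀ (a : ∀ i, α i) (b : ∀ i, β i), law (fun ω : ∀ i, Ω i => ∏ i, P i (ω i))
      (fun ω => ((fun i => A i (ω i)), fun i => B i (ω i))) (a, b) =
      ∏ i, law (P i) (fun s => (A i s, B i s)) (a i, b i) := by
    intro a b
    rw [← law_pi P (fun i s => (A i s, B i s)) fun i => (a i, b i)]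
    exact law_congr _ fun ω => by simp only [Prod.mk.injEq, funext_iff, forall_and]
  simp only [hpair, law_pi]
  have key : ∀ ω : ∀ i, Ω i, (∏ i, P i (ω i)) * Real.log
      ((∏ i, law (P i) (fun s => (A i s, B i s)) (A i (ω i), B i (ω i))) /
        ((∏ i, law (P i) (A i) (A i (ω i))) * ∏ i, law (P i) (B i) (B i (ω i)))) =
      ∑ j, (∏ i, P i (ω i)) * Real.log (law (P j) (fun s => (A j s, B j s)) (A j (ω j), B j (ω j)) /
        (law (P j) (A j) (A j (ω j)) * law (P j) (B j) (B j (ω j)))) := by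
    intro ω
    rw [← Finset.mul_sum]
    rcases eq_or_ne (∏ i, P i (ω i)) 0 with h | h
    · simp [h]
    congr 1
    rw [← Finset.prod_mul_distrib, ← Finset.prod_div_distrib, Real.log_prod]
    intro i _
    have hi : 0 < P i (ω i) := ((hP i).1 _).lt_of_ne' (Finset.prod_ne_zero_iff.1 h i (by simp))
    have h1 := hi.trans_le (le_law (hP i).1 (A i) (ω i))
    have h2 := hi.trans_le (le_law (hP i).1 (B i) (ω i))
    have h3 := hi.trans_le (le_law (hP i).1 (fun s => (A i s, B i s)) (ω i))
    positivity
  simp only [key]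
  rw [Finset.sum_comm]
  refine Finset.sum_congr rfl fun j _ => ?_
  rw [sum_prod_mul_apply (fun i => (hP i).2) j fun s => Real.log
    (law (P j) (fun s => (A j s, B j s)) (A j s, B j s) / (law (P j) (A j) (A j s) *
      law (P j) (B j) (B j s))), mutInfo_eq_sum]

/-- The variance of a sum of i.i.d. centred variables. -/
theorem sum_prod_mul_sq {S : Type*} [Fintype S] {p : S → ℝ} (hp : ∑ s, p s = 1) {h : S → ℝ}
    (hh : ∑ s, p s * h s = 0) :
    ∑ ω : ι → S, (∏ i, p (ω i)) * (∑ i, h (ω i)) ^ 2 = Fintype.card ι * ∑ s, p s * h s ^ 2 := by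
  have hcross : ∀ i j, ∑ ω : ι → S, (∏ k, p (ω k)) * (h (ω i) * h (ω j)) =
      if i = j then ∑ s, p s * h s ^ 2 else 0 := by
    intro i j
    split_ifs with hij
    · subst hij
      simp only [← sq]
      exact sum_prod_mul_apply (fun _ => hp) i fun s => h s ^ 2
    · have h1 : ∀ ω : ι → S, (∏ k, p (ω k)) * (h (ω i) * h (ω j)) =
          ∏ k, (p (ω k) * ((if k = i then h (ω k) else 1) * if k = j then h (ω k) else 1)) := by
        intro ω
        rw [Finset.prod_mul_distrib, Finset.prod_mul_distrib, Finset.prod_ite_eq', Finset.prod_ite_eq']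
        simp
      simp only [h1]
      rw [sum_prod_apply fun k s => p s * ((if k = i then h s else 1) * if k = j then h s else 1)]
      exact Finset.prod_eq_zero (Finset.mem_univ i) (by simpa [hij] using hh)
  calc _ = ∑ ω : ι → S, ∑ i, ∑ j, (∏ k, p (ω k)) * (h (ω i) * h (ω j)) := by
        refine Finset.sum_congr rfl fun ω _ => ?_
        rw [sq, Finset.sum_mul_sum, Finset.mul_sum]
        simp only [Finset.mul_sum]
    _ = ∑ i, ∑ j, ∑ ω : ι → S, (∏ k, p (ω k)) * (h (ω i) * h (ω j)) := by
        rw [Finset.sum_comm]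
        exact Finset.sum_congr rfl fun i _ => Finset.sum_comm
    _ = _ := by simp [hcross]

end Product

/-! ### Random covering and the weak law of large numbers. -/

section Covering

variable {Ω 𝒳 𝒰 : Type*} [Fintype Ω] [Fintype 𝒳] [Fintype 𝒰]

theorem exists_le_of_sum_mul_le {q : 𝒰 → ℝ} (hq : q ∈ stdSimplex ℝ 𝒰) {F : 𝒰 → ℝ} {c : ℝ}
    (h : ∑ u, q u * F u ≤ c) : ∃ u, F u ≤ c := by
  by_contra! hc
  have h1 : ∑ u, q u * (F u - c) ≤ 0 := by
    simp only [mul_sub, Finset.sum_sub_distrib, ← Finset.sum_mul, hq.2]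
    linarith
  have h2 : ∀ u ∈ Finset.univ, 0 ≤ q u * (F u - c) := fun u _ =>
    mul_nonneg (hq.1 u) (sub_pos.2 (hc u)).le
  have h3 := (Finset.sum_eq_zero_iff_of_nonneg h2).1 (le_antisymm h1 (Finset.sum_nonneg h2))
  have h4 : ∑ u, q u = 0 := Finset.sum_eq_zero fun u hu =>
    (mul_eq_zero.1 (h3 u hu)).resolve_right (sub_pos.2 (hc u)).ne'
  exact one_ne_zero (hq.2.symm.trans h4)

open Classical in
-- The right side is the mean uncovered weight for M independent codewords of law q. The codebook is
-- derandomized one codeword at a time: some choice does no worse than the average, and the weights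
-- it covers are then set to zero.
theorem exists_codebook (G : 𝒳 → 𝒰 → Prop) {q : 𝒰 → ℝ} (hq : q ∈ stdSimplex ℝ 𝒰) (M : ℕ)
    (w : 𝒳 → ℝ) :
    ∃ c : Fin M → 𝒰, ∑ x, (if ∃ m, G x (c m) then 0 else w x) ≤
      ∑ x, w x * (1 - ∑ u, if G x u then q u else 0) ^ M := by
  induction M generalizing w with
  | zero => exact ⟨fun i => i.elim0, by simp⟩
  | succ M ih =>
    obtain ⟨u, hu⟩ : ∃ u, ∑ x, (if G x u then 0 else w x) *
        (1 - ∑ u, if G x u then q u else 0) ^ M ≤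
        ∑ x, w x * (1 - ∑ u, if G x u then q u else 0) ^ (M + 1) := by
      refine exists_le_of_sum_mul_le hq (le_of_eq ?_)
      simp only [Finset.mul_sum]
      rw [Finset.sum_comm]
      refine Finset.sum_congr rfl fun x _ => ?_
      have h1 : 1 - ∑ u, (if G x u then q u else 0) = ∑ u, if G x u then 0 else q u := by
        rw [← hq.2, ← Finset.sum_sub_distrib]
        refine Finset.sum_congr rfl fun u _ => ?_
        split_ifs <;> simp
      rw [pow_succ, h1, mul_comm (_ ^ M), ← mul_assoc, Finset.mul_sum, Finset.sum_mul]
      refine Finset.sum_congr rfl fun u _ => ?_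
      split_ifs <;> ring
    obtain ⟨c, hc⟩ := ih fun x => if G x u then 0 else w x
    refine ⟨Fin.cons u c, le_trans (le_of_eq ?_) (hc.trans hu)⟩
    refine Finset.sum_congr rfl fun x _ => ?_
    simp only [Fin.exists_fin_succ, Fin.cons_zero, Fin.cons_succ]
    by_cases h1 : G x u <;> simp [h1]

/-- Convexity of exp between 0 and -aM bounds exp(-abM) by the chord, which separates the failure
probability 1 - b from the codebook-size term. -/
theorem one_sub_pow_le {a b Q : ℝ} (hb : 0 ≤ b) (hb1 : b ≤ 1) (hQ : a * b ≤ Q)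
    (hQ1 : Q ≤ 1) (M : ℕ) : (1 - Q) ^ M ≤ 1 - b + Real.exp (-(a * M)) := by
  have h1 : (1 - Q) ^ M ≤ Real.exp (b * (-(a * M)) + (1 - b) * 0) := by
    calc (1 - Q) ^ M ≤ Real.exp (-(a * b)) ^ M := by
          refine pow_le_pow_left₀ (by linarith) ?_ M
          have := Real.add_one_le_exp (-(a * b))
          linarith
      _ = _ := by rw [← Real.exp_nat_mul]; congr 1; ring
  have h2 := convexOn_exp.2 (Set.mem_univ (-(a * M))) (Set.mem_univ 0) hb (sub_nonneg.2 hb1)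
    (by ring)
  simp only [smul_eq_mul, Real.exp_zero] at h2
  have h3 : b * Real.exp (-(a * M)) ≤ 1 * Real.exp (-(a * M)) :=
    mul_le_mul_of_nonneg_right hb1 (Real.exp_pos _).le
  linarith

open Classical in
/-- The covering lemma: if the joint law of `(X, U)` is at most `a⁻¹` times the product of the
marginals on `G`, then some codebook of size `M` fails to cover `X` with probability at most
`P(Gᶜ) + exp(-a M)`. -/
theorem exists_covering {P : Ω → ℝ} (hP : P ∈ stdSimplex ℝ Ω) (X : Ω → 𝒳) (U : Ω → 𝒰)
    (G : 𝒳 → 𝒰 → Prop) {a : ℝ}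
    (hG : ∀ x u, G x u → a * law P (fun ω => (X ω, U ω)) (x, u) ≤ law P X x * law P U u) (M : ℕ) :
    ∃ c : Fin M → 𝒰, ∑ x, (if ∃ m, G x (c m) then 0 else law P X x) ≤
      ∑ ω, (if G (X ω) (U ω) then 0 else P ω) + Real.exp (-(a * M)) := by
  obtain ⟨c, hc⟩ := exists_codebook G (law_mem_stdSimplex hP U) M (law P X)
  refine ⟨c, hc.trans ?_⟩
  set J := law P fun ω => (X ω, U ω) with hJ
  have hJ0 : ∀ x u, 0 ≤ J (x, u) := fun x u => law_nonneg hP.1 _ _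
  have hX0 : ∀ x, 0 ≤ law P X x := fun x => law_nonneg hP.1 _ _
  have hJX : ∀ x, ∑ u, J (x, u) = law P X x := sum_law_pair_right P X U
  have hsplit : ∀ x, ∑ u, (if G x u then J (x, u) else 0) =
      law P X x - ∑ u, if G x u then 0 else J (x, u) := by
    intro x
    rw [← hJX, ← Finset.sum_sub_distrib]
    refine Finset.sum_congr rfl fun u _ => ?_
    split_ifs <;> simp
  have key : ∀ x, law P X x * (1 - ∑ u, if G x u then law P U u else 0) ^ M ≤
      ∑ u, (if G x u then 0 else J (x, u)) + law P X x * Real.exp (-(a * M)) := by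
    intro x
    rcases (hX0 x).eq_or_lt with hx | hx
    · rw [← hx, zero_mul, zero_mul, add_zero]
      exact Finset.sum_nonneg fun u _ => by split_ifs <;> simp [hJ0]
    have hb0 : 0 ≤ ∑ u, (if G x u then J (x, u) else 0) :=
      Finset.sum_nonneg fun u _ => by split_ifs <;> simp [hJ0]
    have hb1 : ∑ u, (if G x u then J (x, u) else 0) ≤ law P X x := by
      rw [← hJX]
      exact Finset.sum_le_sum fun u _ => by split_ifs <;> simp [hJ0]
    have hQ1 : ∑ u, (if G x u then law P U u else 0) ≤ 1 := by
      rw [← (law_mem_stdSimplex hP U).2]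
      exact Finset.sum_le_sum fun u _ => by split_ifs <;> simp [law_nonneg hP.1]
    -- Here b is the conditional probability of G given X = x; `hG` compares it with the mass of
    -- good codewords under the marginal of U.
    have hQ : a * ((∑ u, if G x u then J (x, u) else 0) / law P X x) ≤
        ∑ u, if G x u then law P U u else 0 := by
      rw [← mul_div_assoc, div_le_iff₀ hx, Finset.mul_sum, Finset.sum_mul]
      refine Finset.sum_le_sum fun u _ => ?_
      split_ifs with h
      · rw [mul_comm (law P U u)]
        exact hG x u h
      · simp
    have h1 := one_sub_pow_le (div_nonneg hb0 hx.le) ((div_le_one hx).2 hb1) hQ hQ1 M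
    calc _ ≤ _ := mul_le_mul_of_nonneg_left h1 hx.le
      _ = law P X x - (∑ u, if G x u then J (x, u) else 0) + law P X x * Real.exp (-(a * M)) := by
        field_simp
      _ = _ := by rw [hsplit]; ring
  calc _ ≤ _ := Finset.sum_le_sum fun x _ => key x
    _ = ∑ x, ∑ u, J (x, u) * (if G x u then 0 else 1) + Real.exp (-(a * M)) := by
      rw [Finset.sum_add_distrib, ← Finset.sum_mul, sum_law, hP.2, one_mul]
      simp
    _ = _ := by
      rw [← Fintype.sum_prod_type' (f := fun x u => J (x, u) * if G x u then 0 else 1), hJ,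
        sum_law_mul P (fun ω => (X ω, U ω)) fun c => if G c.1 c.2 then 0 else 1]
      simp

open Classical in
/-- The weak law of large numbers (lower tail). -/
theorem sum_bad_le {p : 𝒳 → ℝ} (hp : p ∈ stdSimplex ℝ 𝒳) (h : 𝒳 → ℝ) {δ : ℝ} (hδ : 0 < δ)
    {n : ℕ} (hn : 0 < n) :
    ∑ ω, (if n * (∑ s, p s * h s - δ) ≤ ∑ i, h (ω i) then 0 else iid p n ω) ≤
      (∑ s, p s * (h s - ∑ s, p s * h s) ^ 2) / (n * δ ^ 2) := by
  set μ := ∑ s, p s * h s with hμ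
  have hn' : (0 : ℝ) < n := Nat.cast_pos.2 hn
  have hvar := sum_prod_mul_sq (ι := Fin n) hp.2 (h := fun s => h s - μ)
    (by simp only [mul_sub, Finset.sum_sub_distrib, ← Finset.sum_mul, hp.2]; simp [hμ])
  have hw : ∀ ω : Fin n → 𝒳, 0 ≤ iid p n ω := fun ω => Finset.prod_nonneg fun i _ => hp.1 _
  -- Chebyshev's inequality, pointwise: off the good event the squared deviation is at least (nδ)².
  have key : ∀ ω : Fin n → 𝒳, (if n * (μ - δ) ≤ ∑ i, h (ω i) then 0 else iid p n ω) ≤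
      (∏ i, p (ω i)) * (∑ i, (h (ω i) - μ)) ^ 2 * (1 / (n * δ) ^ 2) := by
    intro ω
    have h0 := hw ω
    split_ifs with hc
    · exact mul_nonneg (mul_nonneg h0 (sq_nonneg _)) (by positivity)
    · have h1 : (n * δ) ^ 2 ≤ (∑ i, (h (ω i) - μ)) ^ 2 := by
        rw [Finset.sum_sub_distrib]
        simp only [Finset.sum_const, Finset.card_univ, Fintype.card_fin, nsmul_eq_mul]
        have : 0 < n * δ := by positivity
        nlinarith
      rw [mul_one_div, le_div_iff₀ (by positivity)]
      exact mul_le_mul_of_nonneg_left h1 h0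
  refine (Finset.sum_le_sum fun ω _ => key ω).trans (le_of_eq ?_)
  rw [← Finset.sum_mul, hvar, Fintype.card_fin]
  field_simp

end Covering

/-! ### Conditional laws and Markov chains. -/

section Channel

variable {Ω α β γ : Type*} [Fintype Ω] [Fintype α] [Fintype β] [Fintype γ]

omit [Fintype α] in
/-- A regular conditional law of `B` given `A`. -/
theorem exists_channel {P : Ω → ℝ} (hP : P ∈ stdSimplex ℝ Ω) (A : Ω → α) (B : Ω → β) :
    ∃ W : α → β → ℝ, (∀ a, W a ∈ stdSimplex ℝ β) ∧
      ∀ a b, law P (fun ω => (A ω, B ω)) (a, b) = law P A a * W a b := by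
  classical
  refine ⟨fun a => if law P A a = 0 then law P B else
    fun b => law P (fun ω => (A ω, B ω)) (a, b) / law P A a, fun a => ?_, fun a b => ?_⟩
  · beta_reduce
    split_ifs with h
    · exact law_mem_stdSimplex hP B
    · refine ⟨fun b => div_nonneg (law_nonneg hP.1 _ _) (law_nonneg hP.1 _ _), ?_⟩
      rw [← Finset.sum_div, sum_law_pair_right, div_self h]
  · beta_reduce
    split_ifs with h
    · rw [h, zero_mul]
      exact le_antisymm (h ▸ law_pair_le_left hP.1 A B a b) (law_nonneg hP.1 _ _)
    · rw [mul_div_cancel₀ _ h]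

omit [Fintype β] in
-- Where the middle value has probability zero every joint probability vanishes, so the choice of W
-- there is immaterial.
theorem IsMarkov.law_eq {P : Ω → ℝ} (hP : P ∈ stdSimplex ℝ Ω) {A : Ω → α} {B : Ω → β} {C : Ω → γ}
    (h : IsMarkov P A B C) {W : β → γ → ℝ}
    (hW : ∀ b c, law P (fun ω => (B ω, C ω)) (b, c) = law P B b * W b c) (a : α) (b : β) (c : γ) :
    law P (fun ω => (A ω, B ω, C ω)) (a, b, c) = law P (fun ω => (A ω, B ω)) (a, b) * W b c := by
  rcases eq_or_ne (law P B b) 0 with hb | hb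
  · have h1 : law P (fun ω => (A ω, B ω)) (a, b) = 0 :=
      le_antisymm (hb ▸ law_pair_le_right hP.1 A B a b) (law_nonneg hP.1 _ _)
    have h2 : law P (fun ω => (B ω, C ω)) (b, c) = 0 :=
      le_antisymm (hb ▸ law_pair_le_left hP.1 B C b c) (law_nonneg hP.1 _ _)
    have h3 : law P (fun ω => (A ω, B ω, C ω)) (a, b, c) = 0 :=
      le_antisymm (h2 ▸ law_pair_le_right hP.1 A (fun ω => (B ω, C ω)) a (b, c))
        (law_nonneg hP.1 _ _)
    rw [h1, h3, zero_mul]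
  · have := h a b c
    rw [hW] at this
    refine mul_right_cancel₀ hb (this.trans ?_)
    ring

end Channel

/-! ### One-sided source coding. -/

section OneSided

variable {Ω 𝒰 𝒳 𝒴 : Type*} [Fintype Ω] [Fintype 𝒰] [Fintype 𝒳] [Fintype 𝒴]

theorem iid_mem_stdSimplex {P : Ω → ℝ} (hP : P ∈ stdSimplex ℝ Ω) (n : ℕ) :
    iid P n ∈ stdSimplex ℝ (Fin n → Ω) :=
  prod_mem_stdSimplex fun _ => hP

omit [Fintype 𝒳] in
theorem law_iid (P : Ω → ℝ) (X : Ω → 𝒳) (n : ℕ) :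
    law (iid P n) (fun ω i => X (ω i)) = iid (law P X) n :=
  funext fun x => law_pi (fun _ => P) (fun _ => X) x

omit [Fintype 𝒳] [Fintype 𝒴] in
theorem law_iid_pair (P : Ω → ℝ) (X : Ω → 𝒳) (Y : Ω → 𝒴) (n : ℕ) (x : Fin n → 𝒳)
    (y : Fin n → 𝒴) :
    law (iid P n) (fun ω => ((fun i => X (ω i)), fun i => Y (ω i))) (x, y) =
      ∏ i, law P (fun ω => (X ω, Y ω)) (x i, y i) := by
  refine Eq.trans ?_ (law_pi (fun _ => P) (fun _ ω => (X ω, Y ω)) fun i => (x i, y i))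
  exact law_congr _ fun ω => by simp only [Prod.mk.injEq, funext_iff, forall_and]

/-- A positive density, close to that of the joint law with respect to the product of the
marginals. -/
theorem exists_density {P : Ω → ℝ} (hP : P ∈ stdSimplex ℝ Ω) (U : Ω → 𝒰) (Y : Ω → 𝒴) {δ : ℝ}
    (hδ : 0 < δ) (hδ1 : δ ≤ 1 / 2) :
    ∃ ρ : 𝒰 → 𝒴 → ℝ, (∀ u y, 0 < ρ u y) ∧ (∀ u, ∑ y, law P Y y * ρ u y ≤ 1) ∧
      mutInfo P U Y - 2 * δ ≤ ∑ ω, P ω * Real.log (ρ (U ω) (Y ω)) := by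
  set J := law P fun ω => (U ω, Y ω) with hJ
  have hJ0 : ∀ u y, 0 ≤ J (u, y) := fun u y => law_nonneg hP.1 _ _
  have hU0 : ∀ u, 0 ≤ law P U u := fun u => law_nonneg hP.1 _ _
  have hY0 : ∀ y, 0 ≤ law P Y y := fun y => law_nonneg hP.1 _ _
  have hr : ∀ u y, 0 ≤ (1 - δ) * (J (u, y) / (law P U u * law P Y y)) := fun u y =>
    mul_nonneg (by linarith) (div_nonneg (hJ0 u y) (mul_nonneg (hU0 u) (hY0 y)))
  -- The true density may vanish, which would make the score unusable off the support. Mixing in the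
  -- constant δ keeps it positive and costs at most -log(1 - δ) ≤ 2δ.
  refine ⟨fun u y => (1 - δ) * (J (u, y) / (law P U u * law P Y y)) + δ, fun u y => ?_,
    fun u => ?_, ?_⟩
  · have := hr u y
    linarith
  · have h1 : ∀ y, law P Y y * ((1 - δ) * (J (u, y) / (law P U u * law P Y y)) + δ) ≤
        (1 - δ) * (J (u, y) / law P U u) + law P Y y * δ := by
      intro y
      rw [mul_add]
      refine add_le_add ?_ le_rfl
      rcases eq_or_ne (law P Y y) 0 with h | h
      · rw [h, zero_mul]
        exact mul_nonneg (by linarith) (div_nonneg (hJ0 u y) (hU0 u))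
      · refine le_of_eq ?_
        rw [div_mul_eq_div_div]
        field_simp
    refine (Finset.sum_le_sum fun y _ => h1 y).trans ?_
    rw [Finset.sum_add_distrib, ← Finset.mul_sum, ← Finset.sum_div, ← Finset.sum_mul, sum_law,
      hP.2, sum_law_pair_right]
    have := mul_le_mul_of_nonneg_left (div_self_le_one (law P U u)) (by linarith : 0 ≤ 1 - δ)
    linarith
  · have hlog : -(2 * δ) ≤ Real.log (1 - δ) := by
      have h1 := Real.one_sub_inv_le_log_of_pos (by linarith : 0 < 1 - δ)
      refine le_trans ?_ h1
      have : (1 - δ)⁻¹ ≤ 1 + 2 * δ := by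
        rw [inv_le_iff_one_le_mul₀ (by linarith)]
        nlinarith
      linarith
    have h2 : mutInfo P U Y - 2 * δ = ∑ ω, P ω * (Real.log (J (U ω, Y ω) /
        (law P U (U ω) * law P Y (Y ω))) + -(2 * δ)) := by
      simp only [mul_add, Finset.sum_add_distrib, ← Finset.sum_mul, hP.2]
      rw [mutInfo_eq_sum]
      ring
    rw [h2]
    refine Finset.sum_le_sum fun ω _ => ?_
    rcases (hP.1 ω).eq_or_lt with h | h
    · simp [← h]
    refine mul_le_mul_of_nonneg_left ?_ h.le
    have h3 : 0 < J (U ω, Y ω) := h.trans_le (le_law hP.1 (fun ω => (U ω, Y ω)) ω)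
    have h4 := h.trans_le (le_law hP.1 U ω)
    have h5 := h.trans_le (le_law hP.1 Y ω)
    have h6 : 0 < 1 - δ := by linarith
    calc _ ≤ Real.log (J (U ω, Y ω) / (law P U (U ω) * law P Y (Y ω))) + Real.log (1 - δ) := by
          linarith
      _ = Real.log ((1 - δ) * (J (U ω, Y ω) / (law P U (U ω) * law P Y (Y ω)))) := by
          rw [Real.log_mul h6.ne' (by positivity), add_comm]
      _ ≤ _ := Real.log_le_log (by positivity) (by linarith)

open Classical in
/-- The covering lemma for i.i.d. sources together with a score function. -/
theorem exists_codebook_iid {P : Ω → ℝ} (hP : P ∈ stdSimplex ℝ Ω) (U : Ω → 𝒰) (X : Ω → 𝒳)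
    (d : 𝒳 → 𝒰 → ℝ) {δ : ℝ} (hδ : 0 < δ) :
    ∃ C : ℝ, 0 ≤ C ∧ ∀ n : ℕ, 0 < n → ∀ M : ℕ,
      Real.exp (n * (mutInfo P U X + 2 * δ)) ≤ M →
      ∃ c : Fin M → Fin n → 𝒰, ∑ x : Fin n → 𝒳,
        (if ∃ m, n * (∑ ω, P ω * d (X ω) (U ω) - δ) ≤ ∑ i, d (x i) (c m i) then 0
          else iid (law P X) n x) ≤ C / n := by
  set J := law P fun ω => (X ω, U ω) with hJ
  -- The sign is chosen so that an upper bound on the information density becomes the lower-tail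
  -- event controlled by `sum_bad_le`.
  set ι : 𝒳 → 𝒰 → ℝ := fun x u => -Real.log (J (x, u) / (law P X x * law P U u)) with hι
  set I := mutInfo P U X with hI
  set D := ∑ ω, P ω * d (X ω) (U ω) with hD
  have hιmean : ∑ ω, P ω * ι (X ω) (U ω) = -I := by
    rw [hI, mutInfo_comm, mutInfo_eq_sum, ← Finset.sum_neg_distrib]
    exact Finset.sum_congr rfl fun ω _ => by rw [hι, mul_neg]
  set V₁ := ∑ ω, P ω * (d (X ω) (U ω) - D) ^ 2 with hV₁
  set V₂ := ∑ ω, P ω * (ι (X ω) (U ω) - -I) ^ 2 with hV₂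
  have hV₁0 : 0 ≤ V₁ := Finset.sum_nonneg fun ω _ => mul_nonneg (hP.1 ω) (sq_nonneg _)
  have hV₂0 : 0 ≤ V₂ := Finset.sum_nonneg fun ω _ => mul_nonneg (hP.1 ω) (sq_nonneg _)
  -- Two Chebyshev bounds, for the score and the information density, plus the chance that the
  -- codebook misses.
  refine ⟨V₁ / δ ^ 2 + V₂ / δ ^ 2 + 1 / δ, by positivity, fun n hn M hM => ?_⟩
  have hn' : (0 : ℝ) < n := Nat.cast_pos.2 hn
  have hPn := iid_mem_stdSimplex hP n
  set A : (Fin n → 𝒳) → (Fin n → 𝒰) → Prop := fun x u => n * (D - δ) ≤ ∑ i, d (x i) (u i)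
  set B : (Fin n → 𝒳) → (Fin n → 𝒰) → Prop := fun x u =>
    n * (-I - δ) ≤ ∑ i, ι (x i) (u i)
  obtain ⟨G, hGAB⟩ : ∃ G : (Fin n → 𝒳) → (Fin n → 𝒰) → Prop, ∀ x u, G x u ↔ A x u ∧ B x u :=
    ⟨_, fun _ _ => Iff.rfl⟩
  obtain ⟨c, hc⟩ := exists_covering hPn (fun ω i => X (ω i)) (fun ω i => U (ω i))
    G (a := Real.exp (-(n * (I + δ)))) (by
      intro x u hxu
      have hB := ((hGAB x u).1 hxu).2
      rw [law_iid, law_iid, law_iid_pair]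
      rcases eq_or_ne (∏ i, J (x i, u i)) 0 with h | h
      · rw [← hJ, h, mul_zero]
        exact mul_nonneg (Finset.prod_nonneg fun i _ => law_nonneg hP.1 _ _)
          (Finset.prod_nonneg fun i _ => law_nonneg hP.1 _ _)
      have hpos : ∀ i, 0 < J (x i, u i) := fun i =>
        (law_nonneg hP.1 _ _).lt_of_ne' (Finset.prod_ne_zero_iff.1 h i (Finset.mem_univ i))
      have hX : ∀ i, 0 < law P X (x i) := fun i =>
        (hpos i).trans_le (law_pair_le_left hP.1 X U _ _)
      have hU : ∀ i, 0 < law P U (u i) := fun i =>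
        (hpos i).trans_le (law_pair_le_right hP.1 X U _ _)
      calc _ ≤ Real.exp (∑ i, ι (x i) (u i)) * ∏ i, J (x i, u i) := by
            refine mul_le_mul_of_nonneg_right (Real.exp_le_exp.2 ?_)
              (Finset.prod_nonneg fun i _ => (hpos i).le)
            simp only [B] at hB
            linarith
        _ = _ := by
            simp only [iid]
            rw [Real.exp_sum, ← Finset.prod_mul_distrib, ← Finset.prod_mul_distrib]
            refine Finset.prod_congr rfl fun i _ => ?_
            have h1 := hpos i
            have h2 := hX i
            have h3 := hU i
            rw [hι, Real.exp_neg, Real.exp_log (by positivity)]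
            field_simp) M
  refine ⟨c, ?_⟩
  have hA := sum_bad_le hP (fun ω => d (X ω) (U ω)) hδ hn
  have hB := sum_bad_le hP (fun ω => ι (X ω) (U ω)) hδ hn
  rw [← hD] at hA
  rw [hιmean] at hB
  -- With a = exp(-n(I + δ)) and M ≥ exp(n(I + 2δ)), aM ≥ exp(nδ) ≥ nδ; a crude 1/(nδ) is enough.
  have hexp : Real.exp (-(Real.exp (-(n * (I + δ))) * M)) ≤ 1 / (n * δ) := by
    have h1 : n * δ ≤ Real.exp (-(n * (I + δ))) * M := by
      calc n * δ ≤ n * δ + 1 := by linarith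
        _ ≤ Real.exp (n * δ) := Real.add_one_le_exp _
        _ = Real.exp (-(n * (I + δ))) * Real.exp (n * (I + 2 * δ)) := by
          rw [← Real.exp_add]; congr 1; ring
        _ ≤ _ := mul_le_mul_of_nonneg_left hM (Real.exp_pos _).le
    have h2 : 0 < n * δ := by positivity
    rw [Real.exp_neg, one_div]
    exact inv_anti₀ h2 (h1.trans ((le_add_of_nonneg_right zero_le_one).trans
      (Real.add_one_le_exp _)))
  calc _ ≤ ∑ x : Fin n → 𝒳, (if ∃ m, G x (c m) then 0
          else law (iid P n) (fun ω i => X (ω i)) x) := by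
        refine Finset.sum_le_sum fun x _ => ?_
        rw [law_iid]
        have h0 : 0 ≤ iid (law P X) n x := Finset.prod_nonneg fun i _ => law_nonneg hP.1 _ _
        by_cases h : ∃ m, G x (c m)
        · have h' : ∃ m, A x (c m) := h.imp fun m hm => ((hGAB x (c m)).1 hm).1
          rw [if_pos h, if_pos h']
        · rw [if_neg h]
          split_ifs
          exacts [h0, le_rfl]
    _ ≤ _ := hc
    _ ≤ V₁ / (n * δ ^ 2) + V₂ / (n * δ ^ 2) + 1 / (n * δ) := by
        refine add_le_add (le_trans ?_ (add_le_add hA hB)) hexp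
        rw [← Finset.sum_add_distrib]
        refine Finset.sum_le_sum fun ω _ => ?_
        have h0 : 0 ≤ iid P n ω := hPn.1 ω
        by_cases h1 : A (fun i => X (ω i)) (fun i => U (ω i)) <;>
          by_cases h2 : B (fun i => X (ω i)) (fun i => U (ω i)) <;>
          simp only [hGAB, h1, h2, and_self, and_true, and_false, if_true, if_false] <;>
          simp only [A, B] at h1 h2 <;> simp [h1, h2, h0]
    _ = _ := by field_simp

omit [Fintype 𝒰] in
-- Given Xⁿ the letters of Yⁿ are independent with laws W(xᵢ), so each letter score may be replaced
-- by its conditional mean.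
theorem sum_iid_mul_score {P : Ω → ℝ} (X : Ω → 𝒳) (Y : Ω → 𝒴)
    {W : 𝒳 → 𝒴 → ℝ} (hW : ∀ x, W x ∈ stdSimplex ℝ 𝒴)
    (hXY : ∀ x y, law P (fun ω => (X ω, Y ω)) (x, y) = law P X x * W x y) (L : 𝒰 → 𝒴 → ℝ) (n : ℕ)
    (φ : (Fin n → 𝒳) → Fin n → 𝒰) :
    ∑ ω, iid P n ω * ∑ i, L (φ (fun i => X (ω i)) i) (Y (ω i)) =
      ∑ x, iid (law P X) n x * ∑ i, ∑ y, W (x i) y * L (φ x i) y := by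
  rw [← sum_law_mul (iid P n) (fun ω => ((fun i => X (ω i)), fun i => Y (ω i)))
    fun c => ∑ i, L (φ c.1 i) (c.2 i), Fintype.sum_prod_type]
  refine Finset.sum_congr rfl fun x _ => ?_
  simp only [law_iid_pair, hXY, Finset.prod_mul_distrib, iid, mul_assoc, ← Finset.mul_sum]
  congr 1
  simp only [Finset.mul_sum]
  rw [Finset.sum_comm]
  exact Finset.sum_congr rfl fun i _ =>
    (sum_prod_mul_apply (P := fun i => W (x i)) (fun i => (hW _).2) i fun y => L (φ x i) y).trans rfl

/-- One-sided coding: `X` can be described at rate `I(U; X)` while preserving the information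
`I(U; Y)` about `Y`. -/
theorem exists_encoder {P : Ω → ℝ} (hP : P ∈ stdSimplex ℝ Ω) {U : Ω → 𝒰} {X : Ω → 𝒳} {Y : Ω → 𝒴}
    (hM : IsMarkov P U X Y) {ε : ℝ} (hε : 0 < ε) :
    ∃ n : ℕ, 0 < n ∧ ∃ (m : ℕ) (f : (Fin n → 𝒳) → Fin m),
      Real.log m ≤ n * (mutInfo P U X + ε) ∧
      n * (mutInfo P U Y - ε) ≤
        mutInfo (iid P n) (fun ω => f fun i => X (ω i)) (fun ω i => Y (ω i)) := by
  classical
  -- The information loss is 4δ: 2δ from the density, δ from the typical score, δ from uncovered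
  -- sequences. The rate excess is 3δ, one of them for rounding the codebook size up.
  set δ := min (1 / 2) (ε / 4) with hδdef
  have hδ : 0 < δ := by positivity
  have hδ1 : δ ≤ 1 / 2 := min_le_left _ _
  have hδ2 : 4 * δ ≤ ε := by
    have := min_le_right (1 / 2) (ε / 4)
    rw [← hδdef] at this
    linarith
  obtain ⟨W, hW, hXY⟩ := exists_channel hP X Y
  obtain ⟨ρ, hρ, hρsum, hρlog⟩ := exists_density hP U Y hδ hδ1
  set d : 𝒳 → 𝒰 → ℝ := fun x u => ∑ y, W x y * Real.log (ρ u y) with hd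
  have hDeq : ∑ ω, P ω * d (X ω) (U ω) = ∑ ω, P ω * Real.log (ρ (U ω) (Y ω)) := by
    rw [← sum_law_mul P (fun ω => (U ω, X ω)) fun c => d c.2 c.1,
      ← sum_law_mul P (fun ω => (U ω, X ω, Y ω)) fun c => Real.log (ρ c.1 c.2.2)]
    simp only [Fintype.sum_prod_type, hM.law_eq hP hXY, hd, Finset.mul_sum, mul_assoc]
  obtain ⟨C, hC0, hC⟩ := exists_codebook_iid hP U X d hδ
  set D := ∑ ω, P ω * d (X ω) (U ω) with hD
  obtain ⟨K, hK0, hK⟩ : ∃ K : ℝ, 0 ≤ K ∧ ∀ x u, |d x u| ≤ K :=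
    ⟨∑ x, ∑ u, |d x u|, by positivity, fun x u =>
      (Finset.single_le_sum (f := fun u => |d x u|) (fun _ _ => abs_nonneg _)
        (Finset.mem_univ u)).trans (Finset.single_le_sum (f := fun x => ∑ u, |d x u|)
        (fun _ _ => Finset.sum_nonneg fun _ _ => abs_nonneg _) (Finset.mem_univ x))⟩
  have hDK : D ≤ K := by
    calc D ≤ ∑ ω, P ω * K := Finset.sum_le_sum fun ω _ =>
          mul_le_mul_of_nonneg_left ((le_abs_self _).trans (hK _ _)) (hP.1 ω)
      _ = K := by rw [← Finset.sum_mul, hP.2, one_mul]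
  -- The first bound absorbs the factor 2 from rounding up, the second the total loss 2KC on
  -- uncovered sequences.
  obtain ⟨n, hn⟩ := exists_nat_gt (max (Real.log 2 / δ) (2 * K * C / δ))
  have hn1 : Real.log 2 ≤ n * δ := ((div_lt_iff₀ hδ).1 ((le_max_left _ _).trans_lt hn)).le
  have hn2 : 2 * K * C ≤ n * δ := ((div_lt_iff₀ hδ).1 ((le_max_right _ _).trans_lt hn)).le
  have hn' : (0 : ℝ) < n :=
    (div_nonneg (Real.log_nonneg one_le_two) hδ.le).trans_lt ((le_max_left _ _).trans_lt hn)
  have hn0 : 0 < n := Nat.cast_pos.1 hn'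
  set I := mutInfo P U X with hI
  have hI0 : 0 ≤ I := mutInfo_nonneg hP U X
  set t := Real.exp (n * (I + 2 * δ)) with ht
  have ht1 : 1 ≤ t := Real.one_le_exp (by positivity)
  obtain ⟨c, hc⟩ := hC n hn0 ⌈t⌉₊ (Nat.le_ceil _)
  have hM0 : 0 < ⌈t⌉₊ := Nat.ceil_pos.2 (by linarith)
  set good : (Fin n → 𝒳) → Fin ⌈t⌉₊ → Prop := fun x m => n * (D - δ) ≤ ∑ i, d (x i) (c m i)
  -- An uncovered sequence is sent to index 0; only the bound K on the letter scores is used there.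
  set f : (Fin n → 𝒳) → Fin ⌈t⌉₊ := fun x =>
    if h : ∃ m, good x m then h.choose else ⟨0, hM0⟩ with hf
  refine ⟨n, hn0, ⌈t⌉₊, f, ?_, ?_⟩
  · calc Real.log ⌈t⌉₊ ≤ Real.log (2 * t) := Real.log_le_log (Nat.cast_pos.2 hM0) (by
          have := Nat.ceil_lt_add_one (by linarith : 0 ≤ t)
          linarith)
      _ = Real.log 2 + n * (I + 2 * δ) := by
          rw [Real.log_mul two_ne_zero (Real.exp_pos _).ne', Real.log_exp]
      _ ≤ n * δ + n * (I + 2 * δ) := by linarith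
      _ = n * (I + 3 * δ) := by ring
      _ ≤ _ := mul_le_mul_of_nonneg_left (by linarith) hn'.le
  -- The test density of message m is the product of the letter densities along its codeword.
  · have hvar := sum_mul_log_le_mutInfo (iid_mem_stdSimplex hP n)
      (fun ω => f fun i => X (ω i)) (fun ω i => Y (ω i))
      (ρ := fun m y => ∏ i, ρ (c m i) (y i)) (fun m y => Finset.prod_pos fun i _ => hρ _ _)
      (fun m => by
        simp only [law_iid, iid, ← Finset.prod_mul_distrib]
        rw [sum_prod_apply fun i y => law P Y y * ρ (c m i) y]
        exact Finset.prod_le_one (fun i _ => Finset.sum_nonneg fun y _ =>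
          mul_nonneg (law_nonneg hP.1 _ _) (hρ _ _).le) fun i _ => hρsum _)
    refine le_trans ?_ hvar
    simp only [Real.log_prod fun i _ => (hρ _ _).ne']
    rw [sum_iid_mul_score X Y hW hXY (fun u y => Real.log (ρ u y)) n fun x => c (f x)]
    -- An uncovered sequence scores at least -nK instead of n(D - δ) ≤ nK, a deficit of at most 2nK;
    -- its total mass C/n makes the expected deficit bounded.
    have hpt : ∀ x, iid (law P X) n x * (n * (D - δ)) -
        2 * n * K * (if ∃ m, good x m then 0 else iid (law P X) n x) ≤
        iid (law P X) n x * ∑ i, d (x i) (c (f x) i) := by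
      intro x
      have h0 : 0 ≤ iid (law P X) n x := Finset.prod_nonneg fun i _ => law_nonneg hP.1 _ _
      by_cases h : ∃ m, good x m
      · have hg : good x (f x) := by
          rw [hf]
          simp only [dif_pos h]
          exact h.choose_spec
        rw [if_pos h, mul_zero, sub_zero]
        exact mul_le_mul_of_nonneg_left hg h0
      · rw [if_neg h]
        have h1 : -(n * K) ≤ ∑ i, d (x i) (c (f x) i) := by
          calc -(n * K) = ∑ i : Fin n, -K := by simp
            _ ≤ _ := Finset.sum_le_sum fun i _ => (abs_le.1 (hK _ _)).1
        have h2 : n * (D - δ) ≤ n * K := mul_le_mul_of_nonneg_left (by linarith) hn'.le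
        nlinarith
    refine le_trans ?_ (Finset.sum_le_sum fun x _ => hpt x)
    rw [Finset.sum_sub_distrib, ← Finset.sum_mul, ← Finset.mul_sum,
      (iid_mem_stdSimplex (law_mem_stdSimplex hP X) n).2, one_mul]
    have h3 : 2 * n * K * (∑ x, if ∃ m, good x m then 0 else iid (law P X) n x) ≤
        2 * n * K * (C / n) := mul_le_mul_of_nonneg_left hc (by positivity)
    have h4 : 2 * n * K * (C / n) = 2 * K * C := by field_simp
    have h5 : n * (mutInfo P U Y - ε) ≤ n * (D - 2 * δ) :=
      mul_le_mul_of_nonneg_left (by rw [hDeq]; linarith) hn'.le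
    linarith

end OneSided

/-! ### Concatenation of codes and convexity. -/

section Code

variable {X Z : Type*} [Fintype X] [Fintype Z]

/-- The triple `t` is achieved by a pair of encoders on source blocks indexed by `ι`. -/
def IsCode (p : X × Z → ℝ) (ι : Type) [Fintype ι] [DecidableEq ι] (t : ℝ × ℝ × ℝ) : Prop :=
  ∃ (M₁ M₂ : Type) (_ : Fintype M₁) (_ : Fintype M₂) (f : (ι → X) → M₁) (g : (ι → Z) → M₂),
    Real.log (Fintype.card M₁) ≤ Fintype.card ι * t.2.1 ∧
    Real.log (Fintype.card M₂) ≤ Fintype.card ι * t.2.2 ∧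
    Fintype.card ι * t.1 ≤ mutInfo (fun ω : ι → X × Z => ∏ i, p (ω i))
      (fun ω => f fun i => (ω i).1) (fun ω => g fun i => (ω i).2)

theorem IsCode.congr {p : X × Z → ℝ} {ι κ : Type} [Fintype ι] [DecidableEq ι] [Fintype κ]
    [DecidableEq κ] {t : ℝ × ℝ × ℝ} (h : IsCode p ι t) (e : ι ≃ κ) : IsCode p κ t := by
  obtain ⟨M₁, M₂, _, _, f, g, h1, h2, h3⟩ := h
  refine ⟨M₁, M₂, inferInstance, inferInstance, fun x => f fun i => x (e i),
    fun z => g fun i => z (e i), ?_, ?_, ?_⟩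
  · rwa [← Fintype.card_congr e]
  · rwa [← Fintype.card_congr e]
  · rw [← Fintype.card_congr e]
    refine h3.trans (le_of_eq ?_)
    rw [← mutInfo_equiv _ (Equiv.arrowCongr e.symm (Equiv.refl (X × Z)))]
    congr 1
    funext ω
    exact Equiv.prod_comp e fun k => p (ω k)

theorem IsCode.mem_achievable {p : X × Z → ℝ} {ι : Type} [Fintype ι] [DecidableEq ι] [Nonempty ι]
    {t : ℝ × ℝ × ℝ} (h : IsCode p ι t) : t ∈ achievable p := by
  obtain ⟨M₁, M₂, _, _, f, g, h1, h2, h3⟩ := h.congr (Fintype.equivFin ι)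
  rw [Fintype.card_fin] at h1 h2 h3
  have hn : (0 : ℝ) < Fintype.card ι := Nat.cast_pos.2 Fintype.card_pos
  refine ⟨Fintype.card ι, Fintype.card_pos, Fintype.card M₁, Fintype.card M₂,
    fun x => Fintype.equivFin M₁ (f x), fun z => Fintype.equivFin M₂ (g z), h1, h2, ?_⟩
  rw [one_div, inv_mul_eq_div, le_div_iff₀ hn, mul_comm]
  refine h3.trans (le_of_eq ?_)
  exact (mutInfo_injective_comp (iid p (Fintype.card ι)) (fun ω => f fun i => (ω i).1)
    (fun ω => g fun i => (ω i).2) (Fintype.equivFin M₁).injective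
    (Fintype.equivFin M₂).injective).symm

theorem exists_isCode {p : X × Z → ℝ} {t : ℝ × ℝ × ℝ} (h : t ∈ achievable p) :
    ∃ n : ℕ, 0 < n ∧ IsCode p (Fin n) t := by
  obtain ⟨n, hn, m₁, m₂, f, g, h1, h2, h3⟩ := h
  have hn' : (0 : ℝ) < n := Nat.cast_pos.2 hn
  refine ⟨n, hn, Fin m₁, Fin m₂, inferInstance, inferInstance, f, g, by simpa using h1,
    by simpa using h2, ?_⟩
  rw [one_div, inv_mul_eq_div, le_div_iff₀ hn', mul_comm] at h3
  rw [Fintype.card_fin]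
  exact h3

/-- Concatenation of codes. -/
theorem IsCode.concat {p : X × Z → ℝ} (hp : p ∈ stdSimplex ℝ (X × Z)) {κ ι : Type} [Fintype κ]
    [DecidableEq κ] [Fintype ι] [DecidableEq ι] {t : κ → ℝ × ℝ × ℝ} (h : ∀ j, IsCode p ι (t j))
    {s : ℝ × ℝ × ℝ} (hs : (Fintype.card κ : ℝ) • s = ∑ j, t j) : IsCode p (κ × ι) s := by
  choose M₁ M₂ i₁ i₂ f g h1 h2 h3 using h
  have hs1 : Fintype.card κ * s.1 = ∑ j, (t j).1 := by
    have := congrArg Prod.fst hs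
    simpa [Prod.fst_sum] using this
  have hs2 : Fintype.card κ * s.2.1 = ∑ j, (t j).2.1 := by
    have := congrArg (fun a => a.2.1) hs
    simpa [Prod.fst_sum, Prod.snd_sum] using this
  have hs3 : Fintype.card κ * s.2.2 = ∑ j, (t j).2.2 := by
    have := congrArg (fun a => a.2.2) hs
    simpa [Prod.fst_sum, Prod.snd_sum] using this
  have hlog : ∀ (M : κ → Type) [∀ j, Fintype (M j)] (r : κ → ℝ) (R : ℝ),
      (∀ j, Real.log (Fintype.card (M j)) ≤ Fintype.card ι * r j) →
      Fintype.card κ * R = ∑ j, r j →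
      Real.log (Fintype.card (∀ j, M j)) ≤ Fintype.card (κ × ι) * R := by
    intro M _ r R hM hR
    rw [Fintype.card_prod, Nat.cast_mul, mul_right_comm, hR, mul_comm, Finset.mul_sum,
      Fintype.card_pi, Nat.cast_prod]
    by_cases h0 : ∀ j ∈ Finset.univ, (Fintype.card (M j) : ℝ) ≠ 0
    · rw [Real.log_prod h0]
      exact Finset.sum_le_sum fun j _ => hM j
    -- An empty message set makes the product cardinality 0, and log 0 = 0; the bound survives
    -- because logarithms of naturals are nonnegative.
    · push Not at h0
      obtain ⟨j, hj, hj0⟩ := h0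
      rw [Finset.prod_eq_zero hj hj0, Real.log_zero]
      exact Finset.sum_nonneg fun j _ => (Real.log_natCast_nonneg _).trans (hM j)
  refine ⟨∀ j, M₁ j, ∀ j, M₂ j, inferInstance, inferInstance, fun x j => f j fun i => x (j, i),
    fun z j => g j fun i => z (j, i), hlog M₁ _ _ h1 hs2, hlog M₂ _ _ h2 hs3, ?_⟩
  have hpi := mutInfo_pi (fun _ : κ => prod_mem_stdSimplex fun _ : ι => hp)
    (fun j ω => f j fun i => (ω i).1) (fun j ω => g j fun i => (ω i).2)
  rw [← mutInfo_equiv _ (Equiv.curry κ ι (X × Z))] at hpi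
  calc _ = ∑ j, Fintype.card ι * (t j).1 := by
        rw [Fintype.card_prod, Nat.cast_mul, mul_right_comm, hs1, mul_comm, Finset.mul_sum]
    _ ≤ _ := Finset.sum_le_sum fun j _ => h3 j
    _ = _ := hpi.symm
    _ = _ := by
        congr 1
        funext ω
        rw [Fintype.prod_prod_type]
        rfl

/-- Each code is repeated as many times as the block length of the other. -/
theorem exists_common_isCode {p : X × Z → ℝ} (hp : p ∈ stdSimplex ℝ (X × Z)) {t t' : ℝ × ℝ × ℝ}
    (h : t ∈ achievable p) (h' : t' ∈ achievable p) :
    ∃ n : ℕ, 0 < n ∧ IsCode p (Fin n) t ∧ IsCode p (Fin n) t' := by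
  obtain ⟨n, hn, hc⟩ := exists_isCode h
  obtain ⟨n', hn', hc'⟩ := exists_isCode h'
  have h1 : IsCode p (Fin n' × Fin n) t := IsCode.concat hp (fun _ => hc)
    (by simp [Nat.cast_smul_eq_nsmul])
  have h2 : IsCode p (Fin n × Fin n') t' := IsCode.concat hp (fun _ => hc')
    (by simp [Nat.cast_smul_eq_nsmul])
  refine ⟨n' * n, Nat.mul_pos hn' hn, h1.congr finProdFinEquiv,
    h2.congr ((Equiv.prodComm _ _).trans finProdFinEquiv)⟩

theorem rational_combination_mem_achievable {p : X × Z → ℝ} (hp : p ∈ stdSimplex ℝ (X × Z))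
    {t t' : ℝ × ℝ × ℝ} (h : t ∈ achievable p) (h' : t' ∈ achievable p) {a b : ℕ} (hab : 0 < a + b) :
    ((a : ℝ) / (a + b : ℕ)) • t + ((b : ℝ) / (a + b : ℕ)) • t' ∈ achievable p := by
  obtain ⟨n, hn, hc, hc'⟩ := exists_common_isCode hp h h'
  have : Nonempty (Fin n) := ⟨⟨0, hn⟩⟩
  have : Nonempty (Fin a ⊕ Fin b) := by
    rw [← Fintype.card_pos_iff]
    simpa using hab
  have hab' : ((a + b : ℕ) : ℝ) ≠ 0 := by positivity
  refine (IsCode.concat hp (κ := Fin a ⊕ Fin b) (ι := Fin n)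
    (t := Sum.elim (fun _ => t) fun _ => t') ?_ ?_).mem_achievable
  · rintro (j | j)
    exacts [hc, hc']
  · rw [Fintype.card_sum, Fintype.card_fin, Fintype.card_fin, smul_add, smul_smul, smul_smul,
      mul_div_cancel₀ _ hab', mul_div_cancel₀ _ hab']
    simp [Nat.cast_smul_eq_nsmul]

theorem convex_closure_achievable {p : X × Z → ℝ} (hp : p ∈ stdSimplex ℝ (X × Z)) :
    Convex ℝ (closure (achievable p)) := by
  intro x hx y hy a b ha hb hab
  rw [← closure_closure]
  refine map_mem_closure₂ (f := fun u v : ℝ × ℝ × ℝ => a • u + b • v) (by fun_prop) hx hy ?_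
  intro t ht t' ht'
  have hfl := tendsto_nat_floor_mul_div_atTop (R := ℝ) ha
  have hfl' := hfl.comp tendsto_natCast_atTop_atTop
  -- The weight a is approximated by the rationals ⌊ak⌋/k, for which concatenation applies.
  have hlim : Filter.Tendsto (fun k : ℕ => ((⌊a * k⌋₊ : ℝ) / k) • t + (1 - (⌊a * k⌋₊ : ℝ) / k) • t')
      Filter.atTop (nhds (a • t + (1 - a) • t')) :=
    (hfl'.smul_const t).add ((hfl'.const_sub 1).smul_const t')
  rw [← eq_sub_of_add_eq' hab] at hlim
  refine mem_closure_of_tendsto hlim ((Filter.eventually_gt_atTop 0).mono fun k hk => ?_)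
  have hk' : (k : ℝ) ≠ 0 := by positivity
  have hle : ⌊a * k⌋₊ ≤ k := by
    rw [← Nat.floor_natCast (R := ℝ) k]
    refine Nat.floor_le_floor ?_
    simp only [Nat.floor_natCast]
    exact mul_le_of_le_one_left (Nat.cast_nonneg k) (by linarith)
  have hmem := rational_combination_mem_achievable hp ht ht' (a := ⌊a * k⌋₊) (b := k - ⌊a * k⌋₊)
    (by omega)
  rw [Nat.add_sub_cancel' hle, Nat.cast_sub hle, sub_div, div_self hk'] at hmem
  exact hmem

end Code

/-! ### Stability of Markov chains. -/

section Markov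

variable {Ω α β γ δ : Type*} [Fintype Ω] [Fintype γ]

omit [Fintype γ] in
theorem IsMarkov.symm {P : Ω → ℝ} {A : Ω → α} {B : Ω → β} {C : Ω → γ} (h : IsMarkov P A B C) :
    IsMarkov P C B A := by
  intro c b a
  have h1 : law P (fun ω => (C ω, B ω, A ω)) (c, b, a) = law P (fun ω => (A ω, B ω, C ω)) (a, b, c) :=
    law_congr P fun ω => by simp only [Prod.mk.injEq]; tauto
  rw [h1, h a b c, law_pair_swap P C B, law_pair_swap P B A, mul_comm]

open Classical in
theorem law_pair_comp_right (P : Ω → ℝ) (A : Ω → α) (C : Ω → γ) (g : γ → δ) (a : α) (d : δ) :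
    law P (fun ω => (A ω, g (C ω))) (a, d) =
      ∑ c, law P (fun ω => (A ω, C ω)) (a, c) * if g c = d then 1 else 0 := by
  simp only [law, Finset.sum_mul]
  rw [Finset.sum_comm]
  refine Finset.sum_congr rfl fun ω _ => ?_
  rw [Finset.sum_eq_single (C ω)]
  · by_cases h : A ω = a <;> simp [h]
  · intro c _ hc
    simp [Ne.symm hc]
  · simp

theorem IsMarkov.comp_right {P : Ω → ℝ} {A : Ω → α} {B : Ω → β} {C : Ω → γ}
    (h : IsMarkov P A B C) (g : γ → δ) : IsMarkov P A B fun ω => g (C ω) := by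
  classical
  intro a b d
  have h1 : ∀ {ε : Type _} (D : Ω → ε) (d : ε), law P (fun ω => (A ω, B ω, D ω)) (a, b, d) =
      law P (fun ω => ((A ω, B ω), D ω)) ((a, b), d) := fun D d =>
    law_congr P fun ω => by simp only [Prod.mk.injEq, and_assoc]
  have h2 : ∀ c, law P (fun ω => ((A ω, B ω), C ω)) ((a, b), c) * law P B b =
    law P (fun ω => (A ω, B ω)) (a, b) * law P (fun ω => (B ω, C ω)) (b, c) := fun c =>
    (congrArg (· * law P B b) (law_congr P fun ω => by
      simp only [Prod.mk.injEq, and_assoc])).trans (h a b c)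
  rw [h1, law_pair_comp_right P (fun ω => (A ω, B ω)) C, law_pair_comp_right P B C, Finset.sum_mul,
    Finset.mul_sum]
  refine Finset.sum_congr rfl fun c _ => ?_
  rw [mul_right_comm, h2, mul_assoc]

omit [Fintype γ] in
theorem IsMarkov.iid {P : Ω → ℝ} {A : Ω → α} {B : Ω → β} {C : Ω → γ} (h : IsMarkov P A B C)
    (n : ℕ) : IsMarkov (iid P n) (fun ω i => A (ω i)) (fun ω i => B (ω i)) fun ω i => C (ω i) := by
  intro a b c
  have h1 : law (Biclustering.iid P n)
      (fun ω => ((fun i => A (ω i)), (fun i => B (ω i)), fun i => C (ω i))) (a, b, c) =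
      ∏ i, law P (fun ω => (A ω, B ω, C ω)) (a i, b i, c i) := by
    refine Eq.trans ?_ (law_pi (fun _ => P) (fun _ ω => (A ω, B ω, C ω)) fun i => (a i, b i, c i))
    exact law_congr _ fun ω => by simp only [Prod.mk.injEq, funext_iff, forall_and]
  rw [h1, law_iid_pair, law_iid_pair, law_iid, Biclustering.iid, ← Finset.prod_mul_distrib,
    ← Finset.prod_mul_distrib]
  exact Finset.prod_congr rfl fun i _ => h _ _ _

end Markov

/-! ### The inner region lies in the closure. -/

section Achievability

variable {X Z : Type*} [Fintype X] [Fintype Z]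

theorem mutInfo_iid {Ω α β : Type*} [Fintype Ω] [Fintype α] [Fintype β] {P : Ω → ℝ}
    (hP : P ∈ stdSimplex ℝ Ω) (A : Ω → α) (B : Ω → β) (n : ℕ) :
    mutInfo (iid P n) (fun ω i => A (ω i)) (fun ω i => B (ω i)) = n * mutInfo P A B := by
  have := mutInfo_pi (fun _ : Fin n => hP) (fun _ => A) (fun _ => B)
  simp only [Finset.sum_const, Finset.card_univ, Fintype.card_fin, nsmul_eq_mul] at this
  exact this

/-- Each of the two one-sided codings costs one ε of information and raises one rate by ε. -/
theorem achievable_of_mem_innerWith {p : X × Z → ℝ} {U V : Type} [Fintype U] [Fintype V]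
    {t : ℝ × ℝ × ℝ} (ht : t ∈ innerWith p U V) {ε : ℝ} (hε : 0 < ε) :
    (t.1 - 2 * ε, t.2.1 + ε, t.2.2 + ε) ∈ achievable p := by
  obtain ⟨P, hP, hp, ⟨hM1, hM2⟩, hU, hV, hUV⟩ := ht
  obtain ⟨n, hn, m₁, f, hm₁, hf⟩ := exists_encoder hP (hM1.comp_right Prod.snd) hε
  -- Blocks of length n are now single letters, and f(Xⁿ) is the variable about which information is
  -- to be kept.
  obtain ⟨N, hN, m₂, g, hm₂, hg⟩ := exists_encoder (iid_mem_stdSimplex hP n)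
    (((hM2.symm.comp_right Prod.snd).iid n).comp_right f) hε
  have hn' : (1 : ℝ) ≤ n := Nat.one_le_cast.2 hn
  have hN' : (0 : ℝ) < N := Nat.cast_pos.2 hN
  have : Nonempty (Fin N × Fin n) := ⟨(⟨0, hN⟩, ⟨0, hn⟩)⟩
  refine IsCode.mem_achievable (ι := Fin N × Fin n) ⟨Fin N → Fin m₁, Fin m₂, inferInstance,
    inferInstance, fun x i => f fun j => x (i, j), fun z => g fun i j => z (i, j), ?_, ?_, ?_⟩
  · simp only [Fintype.card_prod, Fintype.card_fin, Fintype.card_pi_const, Nat.cast_mul,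
      Nat.cast_pow, Real.log_pow, mul_assoc]
    refine mul_le_mul_of_nonneg_left (hm₁.trans ?_) hN'.le
    exact mul_le_mul_of_nonneg_left (by linarith) (by linarith)
  · simp only [Fintype.card_prod, Fintype.card_fin, Nat.cast_mul, mul_assoc]
    refine hm₂.trans (mul_le_mul_of_nonneg_left ?_ hN'.le)
    rw [mutInfo_iid hP (fun ω => ω.2.2.2) fun ω => ω.2.2.1]
    nlinarith
  · simp only [Fintype.card_prod, Fintype.card_fin, Nat.cast_mul, mul_assoc]
    rw [mutInfo_comm] at hg
    have h1 : n * (t.1 - 2 * ε) ≤ mutInfo (iid P n) (fun ω => f fun i => (ω i).2.1)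
        (fun ω i => (ω i).2.2.2) - ε := by
      refine le_trans ?_ (sub_le_sub_right hf ε)
      nlinarith
    refine (mul_le_mul_of_nonneg_left h1 hN'.le).trans (hg.trans (le_of_eq ?_))
    rw [mutInfo_comm]
    -- Both messages depend on the source pair alone, so the auxiliary variables can be marginalized
    -- out.
    have h2 := mutInfo_law (iid (iid P n) N) (fun ω i j => ((ω i j).2.1, (ω i j).2.2.1))
      (fun ω i => f fun j => (ω i j).1) (fun ω => g fun i j => (ω i j).2)
    refine h2.symm.trans ?_
    rw [law_iid (iid P n) (fun ω j => ((ω j).2.1, (ω j).2.2.1)),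
      law_iid P fun ω => (ω.2.1, ω.2.2.1), hp,
      ← mutInfo_equiv _ (Equiv.curry (Fin N) (Fin n) (X × Z))]
    congr 1
    funext ω
    rw [Fintype.prod_prod_type]
    rfl

theorem innerWith_subset_closure (p : X × Z → ℝ) (U V : Type) [Fintype U] [Fintype V] :
    innerWith p U V ⊆ closure (achievable p) := by
  intro t ht
  have hlim : Filter.Tendsto (fun ε : ℝ => (t.1 - 2 * ε, t.2.1 + ε, t.2.2 + ε))
      (nhdsWithin 0 (Set.Ioi 0)) (nhds t) := by
    refine Filter.Tendsto.mono_left ?_ nhdsWithin_le_nhds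
    have : Continuous fun ε : ℝ => (t.1 - 2 * ε, t.2.1 + ε, t.2.2 + ε) := by fun_prop
    simpa using this.tendsto 0
  exact mem_closure_of_tendsto hlim
    (Filter.eventually_of_mem self_mem_nhdsWithin fun ε hε => achievable_of_mem_innerWith ht hε)

theorem convexHull_innerRegion_subset {p : X × Z → ℝ} (hp : p ∈ stdSimplex ℝ (X × Z)) :
    convexHull ℝ (innerRegion p) ⊆ closure (achievable p) :=
  convexHull_min (fun _ ⟨_, _, ht⟩ => innerWith_subset_closure p _ _ ht)
    (convex_closure_achievable hp)

end Achievability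

/-! ### Reduction of support under linear constraints. -/

section Support

variable {ι κ : Type*} [Fintype ι] [Fintype κ]

open Classical in
-- The ratio test of the simplex method: τ is the largest step along v preserving nonnegativity, so
-- a minimizing coordinate vanishes while no new coordinate enters the support.
theorem exists_add_smul_support_lt {w v : ι → ℝ} (hw : ∀ i, 0 ≤ w i)
    (hvw : ∀ i, w i = 0 → v i = 0) (hv : ∃ i, v i < 0) :
    ∃ τ : ℝ, 0 < τ ∧ (∀ i, 0 ≤ w i + τ * v i) ∧
      (Finset.univ.filter fun i => w i + τ * v i ≠ 0).card <
        (Finset.univ.filter fun i => w i ≠ 0).card := by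
  obtain ⟨i₀, hi₀⟩ := hv
  obtain ⟨j, hj, hmin⟩ := (Finset.univ.filter fun i => v i < 0).exists_min_image
    (fun i => w i / -v i) ⟨i₀, by simpa using hi₀⟩
  have hj' : v j < 0 := by simpa using hj
  have hwj : w j ≠ 0 := fun h => hj'.ne (hvw j h)
  have hwj' : 0 < w j := (hw j).lt_of_ne' hwj
  refine ⟨w j / -v j, div_pos hwj' (neg_pos.2 hj'), fun i => ?_, ?_⟩
  · rcases lt_or_ge (v i) 0 with h | h
    · have h1 := hmin i (by simpa using h)
      rw [le_div_iff₀ (neg_pos.2 h)] at h1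
      linarith
    · have := mul_nonneg (div_nonneg hwj'.le (neg_pos.2 hj').le) h
      linarith [hw i]
  · refine Finset.card_lt_card ⟨fun i hi => ?_, fun hsub => ?_⟩
    · simp only [Finset.mem_filter, Finset.mem_univ, true_and] at hi ⊢
      intro h
      exact hi (by rw [h, hvw i h]; simp)
    · have h1 := hsub (x := j) (by simpa using hwj)
      simp only [Finset.mem_filter, Finset.mem_univ, true_and] at h1
      refine h1 ?_
      have := hj'.ne
      field_simp
      ring

open Classical in
/-- A nonnegative vector subject to linear constraints, some combination of which is positive on
its support, is a convex combination of such vectors with support no larger than the number of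
constraints. -/
theorem mem_convexHull_small_support (A : κ → ι → ℝ) (y : κ → ℝ) {w : ι → ℝ} (hw : ∀ i, 0 ≤ w i)
    (hy : ∀ i, w i ≠ 0 → 0 < ∑ k, y k * A k i) :
    w ∈ convexHull ℝ {w' : ι → ℝ | (∀ i, 0 ≤ w' i) ∧
      (∀ k, ∑ i, A k i * w' i = ∑ i, A k i * w i) ∧
      (Finset.univ.filter fun i => w' i ≠ 0).card ≤ Fintype.card κ} := by
  induction hN : (Finset.univ.filter fun i => w i ≠ 0).card using Nat.strong_induction_on
    generalizing w with
  | _ N ih =>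
  subst hN
  by_cases hcard : (Finset.univ.filter fun i => w i ≠ 0).card ≤ Fintype.card κ
  · exact subset_convexHull ℝ _ ⟨hw, fun _ => rfl, hcard⟩
  -- More support points than constraints give a nonzero kernel vector supported there. The positive
  -- combination of constraints forces both v and -v to have a negative entry, so w lies between two
  -- points of smaller support.
  obtain ⟨v, hv0, hvw, hAv⟩ : ∃ v : ι → ℝ, v ≠ 0 ∧ (∀ i, w i = 0 → v i = 0) ∧
      ∀ k, ∑ i, A k i * v i = 0 := by
    let L : ({i // w i ≠ 0} → ℝ) →ₗ[ℝ] (κ → ℝ) :=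
      Matrix.mulVecLin (Matrix.of fun k (i : {i // w i ≠ 0}) => A k i)
    have hker : LinearMap.ker L ≠ ⊥ := LinearMap.ker_ne_bot_of_finrank_lt (by
      rw [Module.finrank_pi, Module.finrank_pi, Fintype.card_subtype]
      exact not_le.1 hcard)
    obtain ⟨v, hv, hv0⟩ := (Submodule.ne_bot_iff _).1 hker
    refine ⟨fun i => if h : w i ≠ 0 then v ⟨i, h⟩ else 0, fun h => hv0 ?_, fun i hi => ?_,
      fun k => ?_⟩
    · funext i
      have := congrFun h i.1
      simpa [i.2] using this
    · simp [hi]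
    · have h1 := congrFun (LinearMap.mem_ker.1 hv) k
      simp only [L, Matrix.mulVecLin_apply, Matrix.mulVec, dotProduct, Matrix.of_apply,
        Pi.zero_apply] at h1
      refine Eq.trans ?_ h1
      refine (Fintype.sum_of_injective Subtype.val Subtype.val_injective _ _ (fun i hi => ?_)
        fun i => ?_).symm
      · have : w i = 0 := by
          by_contra h
          exact hi ⟨⟨i, h⟩, rfl⟩
        simp [this]
      · simp [i.2]
  have hsum : ∑ i, (∑ k, y k * A k i) * v i = 0 := by
    simp only [Finset.sum_mul, mul_assoc]
    rw [Finset.sum_comm]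
    simp only [← Finset.mul_sum, hAv, mul_zero, Finset.sum_const_zero]
  have hneg : ∀ v' : ι → ℝ, v' ≠ 0 → (∀ i, w i = 0 → v' i = 0) →
      ∑ i, (∑ k, y k * A k i) * v' i = 0 → ∃ i, v' i < 0 := by
    intro v' hv' hvw' hs
    by_contra! hc
    refine hv' (funext fun i => ?_)
    by_cases hi : w i = 0
    · exact hvw' i hi
    have h1 := (Finset.sum_eq_zero_iff_of_nonneg fun i _ => by
      by_cases hi : w i = 0
      · rw [hvw' i hi, mul_zero]
      · exact mul_nonneg (hy i hi).le (hc i)).1 hs i (Finset.mem_univ i)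
    exact (mul_eq_zero.1 h1).resolve_left (hy i hi).ne'
  have step : ∀ v' : ι → ℝ, v' ≠ 0 → (∀ i, w i = 0 → v' i = 0) → (∀ k, ∑ i, A k i * v' i = 0) →
      ∑ i, (∑ k, y k * A k i) * v' i = 0 →
      ∃ τ : ℝ, 0 < τ ∧ w + τ • v' ∈ convexHull ℝ {w' : ι → ℝ | (∀ i, 0 ≤ w' i) ∧
      (∀ k, ∑ i, A k i * w' i = ∑ i, A k i * w i) ∧
      (Finset.univ.filter fun i => w' i ≠ 0).card ≤ Fintype.card κ} := by
    intro v' h1 h2 h3 h4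
    obtain ⟨τ, hτ, hpos, hlt⟩ := exists_add_smul_support_lt hw h2 (hneg v' h1 h2 h4)
    refine ⟨τ, hτ, ?_⟩
    have hA : ∀ k, ∑ i, A k i * (w + τ • v') i = ∑ i, A k i * w i := by
      intro k
      simp only [Pi.add_apply, Pi.smul_apply, smul_eq_mul, mul_add, Finset.sum_add_distrib,
        mul_left_comm _ τ, ← Finset.mul_sum, h3, mul_zero, add_zero]
    have := ih _ hlt (w := w + τ • v') hpos (fun i hi => hy i fun h => hi (by simp [h, h2 i h])) rfl
    simpa only [hA] using this
  obtain ⟨τ, hτ, h1⟩ := step v hv0 hvw hAv hsum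
  obtain ⟨σ, hσ, h2⟩ := step (-v) (neg_ne_zero.2 hv0) (fun i hi => by simp [hvw i hi])
    (fun k => by simp [hAv]) (by simp [hsum])
  have hcomb := convex_convexHull ℝ _ h1 h2 (a := σ / (τ + σ)) (b := τ / (τ + σ)) (by positivity)
    (by positivity) (by field_simp; ring)
  convert hcomb using 1
  funext i
  simp only [Pi.add_apply, Pi.smul_apply, Pi.neg_apply, smul_eq_mul]
  field_simp
  ring

end Support

/-! ### Contribution of a single letter to mutual information. -/

section Columns

variable {X U U' β : Type*} [Fintype U] [Fintype U'] [Fintype β]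

/-- The contribution to the mutual information of one value of the first variable, `w` being the
corresponding row of the joint pmf and `m` the pmf of the second variable. -/
def rowInfo (w m : β → ℝ) : ℝ :=
  ∑ b, w b * Real.log (w b / ((∑ b', w b') * m b))

/-- The row sum in the denominator cancels the scale inside the logarithm. This homogeneity makes
information linear in column weights. -/
theorem rowInfo_smul (c : ℝ) (w m : β → ℝ) : rowInfo (fun b => c * w b) m = c * rowInfo w m := by
  rcases eq_or_ne c 0 with rfl | hc
  · simp [rowInfo]
  simp only [rowInfo, ← Finset.mul_sum, mul_assoc, mul_div_mul_left _ _ hc]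

theorem mutInfo_eq_sum_rowInfo {Ω α : Type*} [Fintype Ω] [Fintype α] (P : Ω → ℝ) (A : Ω → α)
    (B : Ω → β) :
    mutInfo P A B = ∑ a, rowInfo (fun b => law P (fun ω => (A ω, B ω)) (a, b)) (law P B) := by
  simp only [mutInfo, rowInfo, sum_law_pair_right]

/-- A channel whose output is supported in a finset factors through any alphabet at least as large,
preserving all sums over output letters. -/
theorem exists_channel_relabel {a : X → U → ℝ} (ha : ∀ x, a x ∈ stdSimplex ℝ U) {s : Finset U}
    (hs : ∀ x, ∀ u ∉ s, a x u = 0) (hcard : s.card ≤ Fintype.card U') :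
    ∃ a' : X → U' → ℝ, (∀ x, a' x ∈ stdSimplex ℝ U') ∧
      ∀ F : (X → ℝ) → ℝ, F (fun _ => 0) = 0 → ∑ u, F (fun x => a' x u) = ∑ u, F fun x => a x u := by
  classical
  obtain ⟨e⟩ : Nonempty (s ↪ U') := Function.Embedding.nonempty_of_card_le (by simpa using hcard)
  have key : ∀ F : (X → ℝ) → ℝ, F (fun _ => 0) = 0 →
      ∑ u, F (fun x => Function.extend e (fun i => a x i) 0 u) = ∑ u, F fun x => a x u := by
    intro F hF
    rw [← Fintype.sum_of_injective e e.injective (fun i : s => F fun x => a x i) _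
      (fun u hu => ?_) (fun i => ?_)]
    · refine Fintype.sum_of_injective Subtype.val Subtype.val_injective _ _ (fun u hu => ?_)
        fun _ => rfl
      have hu' : u ∉ s := fun h => hu ⟨⟨u, h⟩, rfl⟩
      simp only [hs _ u hu', hF]
    · have : ∀ x, Function.extend e (fun i : s => a x i) 0 u = 0 := fun x =>
        Function.extend_apply' _ _ _ fun ⟨i, hi⟩ => hu ⟨i, hi⟩
      simp only [this, hF]
    · simp only [e.injective.extend_apply]
  refine ⟨fun x => Function.extend e (fun i => a x i) 0, fun x => ⟨fun u => ?_, ?_⟩, key⟩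
  · beta_reduce
    by_cases hu : ∃ i, e i = u
    · obtain ⟨i, rfl⟩ := hu
      rw [e.injective.extend_apply]
      exact (ha x).1 _
    · rw [Function.extend_apply' _ _ _ hu]
      rfl
  · exact (key (fun c => c x) rfl).trans (ha x).2

end Columns

/-! ### Joint laws built from a pair of channels. -/

section ChannelForm

variable {X Z U V : Type*} [Fintype X] [Fintype Z] [Fintype U] [Fintype V]

/-- The joint pmf of `(U, X, Z, V)` for the channels `a` from `X` to `U` and `b` from `Z` to `V`. -/
def chanLaw (p : X × Z → ℝ) (a : X → U → ℝ) (b : Z → V → ℝ) (ω : U × X × Z × V) : ℝ :=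
  p (ω.2.1, ω.2.2.1) * a ω.2.1 ω.1 * b ω.2.2.1 ω.2.2.2

/-- The contribution of an output letter with column `c` to `I(U; X)`. -/
def rateTerm (q : X → ℝ) (c : X → ℝ) : ℝ :=
  rowInfo (fun x => q x * c x) q

/-- The contribution of an output letter with column `c` to `I(U; V)`. -/
def infoTerm (p : X × Z → ℝ) (b : Z → V → ℝ) (c : X → ℝ) : ℝ :=
  rowInfo (fun v => ∑ x, ∑ z, p (x, z) * c x * b z v) fun v => ∑ x, ∑ z, p (x, z) * b z v

variable {p : X × Z → ℝ} {a : X → U → ℝ} {b : Z → V → ℝ}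

theorem chanLaw_mem_stdSimplex (hp : p ∈ stdSimplex ℝ (X × Z)) (ha : ∀ x, a x ∈ stdSimplex ℝ U)
    (hb : ∀ z, b z ∈ stdSimplex ℝ V) : chanLaw p a b ∈ stdSimplex ℝ (U × X × Z × V) := by
  refine ⟨fun ω => mul_nonneg (mul_nonneg (hp.1 _) ((ha _).1 _)) ((hb _).1 _), ?_⟩
  simp only [Fintype.sum_prod_type, chanLaw, ← Finset.mul_sum, (hb _).2, mul_one]
  rw [Finset.sum_comm]
  have : ∀ x, ∑ u, ∑ z, p (x, z) * a x u = ∑ z, p (x, z) := fun x => by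
    rw [Finset.sum_comm]
    simp only [← Finset.mul_sum, (ha _).2, mul_one]
  simp only [this]
  rw [← Fintype.sum_prod_type, hp.2]

theorem law_chanLaw_XZ (ha : ∀ x, a x ∈ stdSimplex ℝ U) (hb : ∀ z, b z ∈ stdSimplex ℝ V) :
    law (chanLaw p a b) (fun ω => (ω.2.1, ω.2.2.1)) = p := by
  classical
  funext ⟨x, z⟩
  simp only [law, Fintype.sum_prod_type, chanLaw, Prod.mk.injEq, ite_and]
  simp [← Finset.mul_sum, (ha _).2, (hb _).2]

theorem law_chanLaw_UX (hb : ∀ z, b z ∈ stdSimplex ℝ V) (u : U) (x : X) :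
    law (chanLaw p a b) (fun ω => (ω.1, ω.2.1)) (u, x) = (∑ z, p (x, z)) * a x u := by
  classical
  simp only [law, Fintype.sum_prod_type, chanLaw, Prod.mk.injEq, ite_and]
  simp [← Finset.mul_sum, ← Finset.sum_mul, (hb _).2]

end ChannelForm

theorem law_self {Ω : Type*} [Fintype Ω] (P : Ω → ℝ) (ω : Ω) : law P (fun ω => ω) ω = P ω := by
  classical
  rw [law, Finset.sum_eq_single ω]
  · simp
  · intro b _ hb
    simp [hb]
  · simp

theorem IsMarkov.equiv {Ω Ω' α β γ : Type*} [Fintype Ω] [Fintype Ω'] {P : Ω → ℝ} {A : Ω → α}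
    {B : Ω → β} {C : Ω → γ} (h : IsMarkov P A B C) (e : Ω' ≃ Ω) :
    IsMarkov (fun ω => P (e ω)) (fun ω => A (e ω)) (fun ω => B (e ω)) fun ω => C (e ω) := by
  intro a b c
  rw [law_equiv P e B, law_equiv P e fun ω => (A ω, B ω), law_equiv P e fun ω => (B ω, C ω),
    law_equiv P e fun ω => (A ω, B ω, C ω)]
  exact h a b c

section ChannelForm

variable {X Z U V : Type*} [Fintype X] [Fintype Z] [Fintype U] [Fintype V]
variable {p : X × Z → ℝ} {a : X → U → ℝ} {b : Z → V → ℝ}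

theorem law_chanLaw_X (ha : ∀ x, a x ∈ stdSimplex ℝ U) (hb : ∀ z, b z ∈ stdSimplex ℝ V) (x : X) :
    law (chanLaw p a b) (fun ω => ω.2.1) x = ∑ z, p (x, z) := by
  rw [← sum_law_pair_left (chanLaw p a b) (fun ω => ω.1) (fun ω => ω.2.1)]
  simp only [law_chanLaw_UX hb, ← Finset.mul_sum, (ha _).2, mul_one]

theorem law_chanLaw_VZ (ha : ∀ x, a x ∈ stdSimplex ℝ U) (v : V) (z : Z) :
    law (chanLaw p a b) (fun ω => (ω.2.2.2, ω.2.2.1)) (v, z) = (∑ x, p (x, z)) * b z v := by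
  classical
  simp only [law, Fintype.sum_prod_type, chanLaw, Prod.mk.injEq, ite_and]
  simp only [Finset.sum_ite_eq', Finset.mem_univ, if_true]
  rw [Finset.sum_comm]
  simp [← Finset.mul_sum, ← Finset.sum_mul, (ha _).2]

theorem law_chanLaw_Z (ha : ∀ x, a x ∈ stdSimplex ℝ U) (hb : ∀ z, b z ∈ stdSimplex ℝ V) (z : Z) :
    law (chanLaw p a b) (fun ω => ω.2.2.1) z = ∑ x, p (x, z) := by
  rw [← sum_law_pair_left (chanLaw p a b) (fun ω => ω.2.2.2) (fun ω => ω.2.2.1)]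
  simp only [law_chanLaw_VZ ha, ← Finset.mul_sum, (hb _).2, mul_one]

theorem law_chanLaw_UV (p : X × Z → ℝ) (a : X → U → ℝ) (b : Z → V → ℝ) (u : U) (v : V) :
    law (chanLaw p a b) (fun ω => (ω.1, ω.2.2.2)) (u, v) =
      ∑ x, ∑ z, p (x, z) * a x u * b z v := by
  classical
  simp only [law, Fintype.sum_prod_type, chanLaw, Prod.mk.injEq, ite_and]
  simp

/-- The channel `a` drops out, so reweighting its columns leaves the law of V, and hence the
denominators in `infoTerm`, unchanged. -/
theorem law_chanLaw_V (ha : ∀ x, a x ∈ stdSimplex ℝ U) (v : V) :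
    law (chanLaw p a b) (fun ω => ω.2.2.2) v = ∑ x, ∑ z, p (x, z) * b z v := by
  rw [← sum_law_pair_left (chanLaw p a b) (fun ω => ω.1) (fun ω => ω.2.2.2)]
  simp only [law_chanLaw_UV]
  rw [Finset.sum_comm]
  refine Finset.sum_congr rfl fun x _ => ?_
  rw [Finset.sum_comm]
  simp only [← Finset.sum_mul, ← Finset.mul_sum, (ha _).2, mul_one]

theorem isMarkov₄_chanLaw (ha : ∀ x, a x ∈ stdSimplex ℝ U) (hb : ∀ z, b z ∈ stdSimplex ℝ V) :
    IsMarkov₄ (chanLaw p a b) (fun ω => ω.1) (fun ω => ω.2.1) (fun ω => ω.2.2.1)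
      (fun ω => ω.2.2.2) := by
  classical
  refine ⟨fun u x c => ?_, fun c z v => ?_⟩
  · obtain ⟨z, v⟩ := c
    have h1 : law (chanLaw p a b) (fun ω => (ω.1, ω.2.1, ω.2.2.1, ω.2.2.2)) (u, x, z, v) =
        chanLaw p a b (u, x, z, v) := law_self _ _
    have h2 : law (chanLaw p a b) (fun ω => (ω.2.1, ω.2.2.1, ω.2.2.2)) (x, z, v) =
        p (x, z) * b z v := by
      simp only [law, Fintype.sum_prod_type, chanLaw, Prod.mk.injEq, ite_and]
      simp [← Finset.mul_sum, ← Finset.sum_mul, (ha _).2]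
    rw [h1, h2, law_chanLaw_X ha hb, law_chanLaw_UX hb, chanLaw]
    ring
  · obtain ⟨u, x⟩ := c
    have h1 : law (chanLaw p a b) (fun ω => ((ω.1, ω.2.1), ω.2.2.1, ω.2.2.2)) ((u, x), z, v) =
        chanLaw p a b (u, x, z, v) := by
      refine Eq.trans (law_congr _ fun ω => ?_)
        (law_self (chanLaw p a b) (u, x, z, v))
      simp only [Prod.ext_iff, and_assoc]
    have h2 : law (chanLaw p a b) (fun ω => ((ω.1, ω.2.1), ω.2.2.1)) ((u, x), z) =
        p (x, z) * a x u := by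
      simp only [law, Fintype.sum_prod_type, chanLaw, Prod.mk.injEq, ite_and]
      simp [← Finset.mul_sum, (hb _).2]
    rw [h1, h2, law_chanLaw_Z ha hb, law_pair_swap, law_chanLaw_VZ ha, chanLaw]
    ring

theorem mutInfo_chanLaw_UX (ha : ∀ x, a x ∈ stdSimplex ℝ U) (hb : ∀ z, b z ∈ stdSimplex ℝ V) :
    mutInfo (chanLaw p a b) (fun ω => ω.1) (fun ω => ω.2.1) =
      ∑ u, rateTerm (fun x => ∑ z, p (x, z)) fun x => a x u := by
  rw [mutInfo_eq_sum_rowInfo]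
  simp only [law_chanLaw_UX hb, rateTerm]
  rw [show law (chanLaw p a b) (fun ω => ω.2.1) = _ from funext (law_chanLaw_X ha hb)]

theorem mutInfo_chanLaw_VZ (ha : ∀ x, a x ∈ stdSimplex ℝ U) (hb : ∀ z, b z ∈ stdSimplex ℝ V) :
    mutInfo (chanLaw p a b) (fun ω => ω.2.2.2) (fun ω => ω.2.2.1) =
      ∑ v, rateTerm (fun z => ∑ x, p (x, z)) fun z => b z v := by
  rw [mutInfo_eq_sum_rowInfo]
  simp only [law_chanLaw_VZ ha, rateTerm]
  rw [show law (chanLaw p a b) (fun ω => ω.2.2.1) = _ from funext (law_chanLaw_Z ha hb)]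

theorem mutInfo_chanLaw_UV (ha : ∀ x, a x ∈ stdSimplex ℝ U) :
    mutInfo (chanLaw p a b) (fun ω => ω.1) (fun ω => ω.2.2.2) =
      ∑ u, infoTerm p b fun x => a x u := by
  rw [mutInfo_eq_sum_rowInfo]
  simp only [law_chanLaw_UV, infoTerm]
  rw [show law (chanLaw p a b) (fun ω => ω.2.2.2) = _ from funext (law_chanLaw_V ha)]

end ChannelForm

/-! ### The inner region in terms of channels. -/

section Regions

variable {X Z : Type*} [Fintype X] [Fintype Z] {p : X × Z → ℝ}

/-- The Markov conditions say exactly that the joint pmf is p times two channels, so the region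
becomes a statement about sums over channel columns. -/
theorem mem_innerWith_iff (hp : p ∈ stdSimplex ℝ (X × Z)) {U V : Type} [Fintype U] [Fintype V]
    {t : ℝ × ℝ × ℝ} :
    t ∈ innerWith p U V ↔ ∃ (a : X → U → ℝ) (b : Z → V → ℝ),
      (∀ x, a x ∈ stdSimplex ℝ U) ∧ (∀ z, b z ∈ stdSimplex ℝ V) ∧
      ∑ u, rateTerm (fun x => ∑ z, p (x, z)) (fun x => a x u) ≤ t.2.1 ∧
      ∑ v, rateTerm (fun z => ∑ x, p (x, z)) (fun z => b z v) ≤ t.2.2 ∧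
      t.1 ≤ ∑ u, infoTerm p b fun x => a x u := by
  constructor
  · rintro ⟨P, hP, hXZ, ⟨hM1, hM2⟩, hU, hV, hUV⟩
    obtain ⟨a, ha, haP⟩ := exists_channel hP (fun ω => ω.2.1) fun ω => ω.1
    obtain ⟨b, hb, hbP⟩ := exists_channel hP (fun ω => ω.2.2.1) fun ω => ω.2.2.2
    have hPeq : P = chanLaw p a b := by
      funext ω
      obtain ⟨u, x, z, v⟩ := ω
      have h1 := hM2.law_eq hP hbP (u, x) z v
      have h2 := (hM1.comp_right Prod.fst).symm.law_eq hP haP z x u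
      have h3 : law P (fun ω => ((ω.1, ω.2.1), ω.2.2.1)) ((u, x), z) =
          law P (fun ω => (ω.2.2.1, ω.2.1, ω.1)) (z, x, u) :=
        law_congr P fun ω => by simp only [Prod.mk.injEq]; tauto
      have h4 : law P (fun ω => ((ω.1, ω.2.1), ω.2.2.1, ω.2.2.2)) ((u, x), z, v) =
          P (u, x, z, v) := by
        classical
        refine Eq.trans (law_congr P fun ω => ?_)
          (law_self P (u, x, z, v))
        simp only [Prod.ext_iff, and_assoc]
      rw [← h4, h1, h3, h2, law_pair_swap, hXZ, chanLaw]
    subst hPeq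
    rw [mutInfo_chanLaw_UX ha hb] at hU
    rw [mutInfo_chanLaw_VZ ha hb] at hV
    rw [mutInfo_chanLaw_UV ha] at hUV
    exact ⟨a, b, ha, hb, hU, hV, hUV⟩
  · rintro ⟨a, b, ha, hb, hU, hV, hUV⟩
    refine ⟨chanLaw p a b, chanLaw_mem_stdSimplex hp ha hb, law_chanLaw_XZ ha hb,
      isMarkov₄_chanLaw ha hb, ?_, ?_, ?_⟩
    · rwa [mutInfo_chanLaw_UX ha hb]
    · rwa [mutInfo_chanLaw_VZ ha hb]
    · rwa [mutInfo_chanLaw_UV ha]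

theorem mem_innerWith_swap {U V : Type} [Fintype U] [Fintype V] {t : ℝ × ℝ × ℝ}
    (h : t ∈ innerWith p U V) : (t.1, t.2.2, t.2.1) ∈ innerWith (fun s => p s.swap) V U := by
  obtain ⟨P, hP, hXZ, ⟨hM1, hM2⟩, hU, hV, hUV⟩ := h
  let e : V × Z × X × U ≃ U × X × Z × V :=
    { toFun := fun ω => (ω.2.2.2, ω.2.2.1, ω.2.1, ω.1)
      invFun := fun ω => (ω.2.2.2, ω.2.2.1, ω.2.1, ω.1)
      left_inv := fun _ => rfl
      right_inv := fun _ => rfl }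
  refine ⟨fun ω => P (e ω), ⟨fun ω => hP.1 _, (Equiv.sum_comp e P).trans hP.2⟩, ?_,
    ⟨(hM2.symm.comp_right Prod.swap).equiv e, ((hM1.comp_right Prod.swap).symm).equiv e⟩,
    ?_, ?_, ?_⟩
  · refine (law_equiv P e fun ω => (ω.2.2.1, ω.2.1)).trans ?_
    rw [← hXZ]
    funext s
    exact law_pair_swap _ _ _ _ _
  · exact (mutInfo_equiv P e (fun ω => ω.2.2.2) fun ω => ω.2.2.1).trans_le hV
  · exact (mutInfo_equiv P e (fun ω => ω.1) fun ω => ω.2.1).trans_le hU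
  · rw [mutInfo_comm] at hUV
    exact hUV.trans_eq (mutInfo_equiv P e (fun ω => ω.2.2.2) fun ω => ω.1).symm

end Regions

/-! ### Cardinality bounds for the auxiliary alphabets. -/

section Cardinality

variable {X Z : Type*} [Fintype X] [Fintype Z]

theorem rateTerm_smul (q : X → ℝ) (k : ℝ) (c : X → ℝ) :
    rateTerm q (fun x => k * c x) = k * rateTerm q c := by
  rw [rateTerm, rateTerm, ← rowInfo_smul]
  simp only [mul_left_comm]

theorem rateTerm_zero (q : X → ℝ) : rateTerm q (fun _ => 0) = 0 := by
  simpa using rateTerm_smul q 0 fun _ => 0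

theorem infoTerm_smul {V : Type*} [Fintype V] (p : X × Z → ℝ) (b : Z → V → ℝ) (k : ℝ) (c : X → ℝ) :
    infoTerm p b (fun x => k * c x) = k * infoTerm p b c := by
  rw [infoTerm, infoTerm, ← rowInfo_smul]
  simp only [Finset.mul_sum]
  congr 1
  funext v
  exact Finset.sum_congr rfl fun x _ => Finset.sum_congr rfl fun z _ => by ring

theorem infoTerm_zero {V : Type*} [Fintype V] (p : X × Z → ℝ) (b : Z → V → ℝ) :
    infoTerm p b (fun _ => 0) = 0 := by
  simpa using infoTerm_smul p b 0 fun _ => 0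

variable {p : X × Z → ℝ}

theorem swap_mem_stdSimplex (hp : p ∈ stdSimplex ℝ (X × Z)) :
    (fun s : Z × X => p s.swap) ∈ stdSimplex ℝ (Z × X) :=
  ⟨fun _ => hp.1 _, (Equiv.sum_comp (Equiv.prodComm Z X) p).trans hp.2⟩

theorem innerWith_mono_left (hp : p ∈ stdSimplex ℝ (X × Z)) {U U' V : Type} [Fintype U]
    [Fintype U'] [Fintype V] (h : Fintype.card U ≤ Fintype.card U') :
    innerWith p U V ⊆ innerWith p U' V := by
  intro t ht
  obtain ⟨a, b, ha, hb, h1, h2, h3⟩ := (mem_innerWith_iff hp).1 ht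
  obtain ⟨a', ha', hF⟩ := exists_channel_relabel ha (s := Finset.univ) (by simp)
    (h.trans_eq' Finset.card_univ)
  refine (mem_innerWith_iff hp).2 ⟨a', b, ha', hb, ?_, h2, ?_⟩
  · rwa [hF _ (rateTerm_zero _)]
  · rwa [hF _ (infoTerm_zero _ _)]

theorem innerWith_mono (hp : p ∈ stdSimplex ℝ (X × Z)) {U U' V V' : Type} [Fintype U]
    [Fintype U'] [Fintype V] [Fintype V'] (h : Fintype.card U ≤ Fintype.card U')
    (h' : Fintype.card V ≤ Fintype.card V') : innerWith p U V ⊆ innerWith p U' V' := fun _ ht =>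
  mem_innerWith_swap (innerWith_mono_left (swap_mem_stdSimplex hp) h'
    (mem_innerWith_swap (innerWith_mono_left hp h ht)))

theorem innerRegionBounded_eq (hp : p ∈ stdSimplex ℝ (X × Z)) :
    innerRegionBounded p = innerWith p (Fin (Fintype.card X)) (Fin (Fintype.card Z)) := by
  refine Set.Subset.antisymm ?_ fun t ht => ⟨_, _, le_rfl, le_rfl, ht⟩
  rintro t ⟨k, l, hk, hl, ht⟩
  exact innerWith_mono hp (by simpa using hk) (by simpa using hl) ht

theorem innerWith_subset_convexHull_left (hp : p ∈ stdSimplex ℝ (X × Z)) (U V : Type) [Fintype U]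
    [Fintype V] : innerWith p U V ⊆ convexHull ℝ (innerWith p (Fin (Fintype.card X)) V) := by
  classical
  intro t ht
  obtain ⟨a, b, ha, hb, h1, h2, h3⟩ := (mem_innerWith_iff hp).1 ht
  set F : U → ℝ := fun u => rateTerm (fun x => ∑ z, p (x, z)) fun x => a x u with hF
  set G : U → ℝ := fun u => infoTerm p b fun x => a x u with hG
  -- Zero columns get weight 0, since every supported column must have positive sum for the support
  -- reduction; they contribute nothing anyway.
  set w : U → ℝ := fun u => if ∃ x, a x u ≠ 0 then 1 else 0 with hw
  have hwa : ∀ u x, w u * a x u = a x u := by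
    intro u x
    by_cases h : ∃ x, a x u ≠ 0
    · simp [hw, h]
    · push Not at h
      simp [h x]
  have hmem := mem_convexHull_small_support a (fun _ => 1) (w := w)
    (fun u => by simp only [hw]; split_ifs <;> simp) (fun u hu => by
      have hex : ∃ x, a x u ≠ 0 := by
        by_contra h
        exact hu (by simp only [hw, if_neg h])
      obtain ⟨x, hx⟩ := hex
      refine Finset.sum_pos' (fun x _ => by simpa using (ha x).1 u)
        ⟨x, Finset.mem_univ x, by simpa using ((ha x).1 u).lt_of_ne' hx⟩)
  -- The last coordinate is 0 because I(V;Z) does not depend on the weights.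
  let T : (U → ℝ) →ₗ[ℝ] ℝ × ℝ × ℝ :=
    (Fintype.linearCombination ℝ G).prod ((Fintype.linearCombination ℝ F).prod 0)
  have hT : ∀ v, T v = (∑ u, v u * G u, ∑ u, v u * F u, 0) := fun v => rfl
  have hFw : ∑ u, w u * F u = ∑ u, F u := Finset.sum_congr rfl fun u _ => by
    rw [hF, ← rateTerm_smul]
    simp only [hwa]
  have hGw : ∑ u, w u * G u = ∑ u, G u := Finset.sum_congr rfl fun u _ => by
    rw [hG, ← infoTerm_smul]
    simp only [hwa]
  -- Adding the slack t - T w carries the inequalities at w over to every reweighting and recovers t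
  -- at v = w.
  suffices h : w ∈ {v | T v + (t - T w) ∈ convexHull ℝ (innerWith p (Fin (Fintype.card X)) V)} by
    simpa using h
  refine convexHull_min ?_ ?_ hmem
  · rintro v ⟨hv0, hv1, hv2⟩
    refine subset_convexHull ℝ _ ((mem_innerWith_iff hp).2 ?_)
    have hva : ∀ x, (fun u => v u * a x u) ∈ stdSimplex ℝ U := fun x =>
      ⟨fun u => mul_nonneg (hv0 u) ((ha x).1 u), by
        have := hv1 x
        simp only [mul_comm (a x _), hwa] at this
        exact this.trans (ha x).2⟩
    obtain ⟨a', ha', hF'⟩ := exists_channel_relabel (U' := Fin (Fintype.card X)) hva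
      (s := Finset.univ.filter fun u => v u ≠ 0) (fun x u hu => by
        have : v u = 0 := by simpa using hu
        simp [this]) (by simpa using hv2)
    refine ⟨a', b, ha', hb, ?_, ?_, ?_⟩
    · rw [hF' _ (rateTerm_zero _), hT, hT, hFw]
      simp only [rateTerm_smul, Prod.snd_add, Prod.fst_add, Prod.snd_sub, Prod.fst_sub]
      simp only [hF] at h1 ⊢
      linarith
    · simpa [hT] using h2
    · rw [hF' _ (infoTerm_zero _ _), hT, hT, hGw]
      simp only [infoTerm_smul, Prod.fst_add, Prod.fst_sub]
      simp only [hG] at h3 ⊢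
      linarith
  · intro v hv v' hv' c d hc hd hcd
    have := convex_convexHull ℝ (innerWith p (Fin (Fintype.card X)) V) hv hv' hc hd hcd
    simp only [Set.mem_ofPred_eq, map_add, map_smul]
    convert this using 1
    rw [smul_add, smul_add, add_add_add_comm, ← add_smul, hcd, one_smul]

theorem innerWith_subset_convexHull_right (hp : p ∈ stdSimplex ℝ (X × Z)) (U V : Type) [Fintype U]
    [Fintype V] : innerWith p U V ⊆ convexHull ℝ (innerWith p U (Fin (Fintype.card Z))) := by
  intro t ht
  have h := innerWith_subset_convexHull_left (swap_mem_stdSimplex hp) V U (mem_innerWith_swap ht)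
  let T : ℝ × ℝ × ℝ →ₗ[ℝ] ℝ × ℝ × ℝ :=
    LinearMap.prodMap LinearMap.id (LinearEquiv.prodComm ℝ ℝ ℝ).toLinearMap
  have h2 := Set.mem_image_of_mem T h
  rw [LinearMap.image_convexHull] at h2
  refine convexHull_mono ?_ h2
  rintro _ ⟨s, hs, rfl⟩
  exact mem_innerWith_swap hs

theorem convexHull_innerRegionBounded (hp : p ∈ stdSimplex ℝ (X × Z)) :
    convexHull ℝ (innerRegionBounded p) = convexHull ℝ (innerRegion p) := by
  refine Set.Subset.antisymm
    (convexHull_mono fun t ⟨k, l, _, _, ht⟩ => ⟨k, l, ht⟩) (convexHull_min ?_ (convex_convexHull ℝ _))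
  rintro t ⟨k, l, ht⟩
  rw [innerRegionBounded_eq hp]
  exact convexHull_min (innerWith_subset_convexHull_right hp _ _) (convex_convexHull ℝ _)
    (innerWith_subset_convexHull_left hp _ _ ht)

end Cardinality

/-! ### Time sharing and the bound on its alphabet. -/

section TimeSharing

/-- The factors r(c) cancel inside the logarithm, and values with r(c) = 0 contribute nothing on
either side. -/
theorem condMutInfo_eq_sum {Ω Ω' α β γ : Type*} [Fintype Ω] [Fintype Ω'] [Fintype α] [Fintype β]
    [Fintype γ] {P : Ω → ℝ} {A : Ω → α} {B : Ω → β} {C : Ω → γ} {r : γ → ℝ} {P' : γ → Ω' → ℝ}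
    (hP' : ∀ c, ∑ ω, P' c ω = 1) (A' : Ω' → α) (B' : Ω' → β)
    (h : ∀ a b c, law P (fun ω => (A ω, B ω, C ω)) (a, b, c) =
      r c * law (P' c) (fun ω => (A' ω, B' ω)) (a, b)) :
    condMutInfo P A B C = ∑ c, r c * mutInfo (P' c) A' B' := by
  have hBC : ∀ b c, law P (fun ω => (B ω, C ω)) (b, c) = r c * law (P' c) B' b := by
    intro b c
    rw [← sum_law_pair_left P A fun ω => (B ω, C ω)]
    simp only [h, ← Finset.mul_sum, sum_law_pair_left]
  have hAC : ∀ a c, law P (fun ω => (A ω, C ω)) (a, c) = r c * law (P' c) A' a := by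
    intro a c
    rw [← sum_law_pair_left P B fun ω => (A ω, C ω)]
    have : ∀ b, law P (fun ω => (B ω, A ω, C ω)) (b, a, c) =
        law P (fun ω => (A ω, B ω, C ω)) (a, b, c) := fun b =>
      law_congr P fun ω => by simp only [Prod.mk.injEq]; tauto
    simp only [this, h, ← Finset.mul_sum, sum_law_pair_right]
  have hC : ∀ c, law P C c = r c := by
    intro c
    rw [← sum_law_pair_left P B C]
    simp only [hBC, ← Finset.mul_sum, sum_law, hP', mul_one]
  have hterm : ∀ a b c, r c * law (P' c) (fun ω => (A' ω, B' ω)) (a, b) * Real.log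
      (r c * law (P' c) (fun ω => (A' ω, B' ω)) (a, b) * r c /
        (r c * law (P' c) A' a * (r c * law (P' c) B' b))) =
      r c * (law (P' c) (fun ω => (A' ω, B' ω)) (a, b) * Real.log
        (law (P' c) (fun ω => (A' ω, B' ω)) (a, b) / (law (P' c) A' a * law (P' c) B' b))) := by
    intro a b c
    rcases eq_or_ne (r c) 0 with hr | hr
    · simp [hr]
    rw [mul_assoc]
    congr 3
    rw [mul_mul_mul_comm, mul_right_comm, mul_div_mul_left _ _ (mul_ne_zero hr hr)]
  simp only [condMutInfo, h, hBC, hAC, hC, hterm, mutInfo, Finset.mul_sum]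
  calc _ = ∑ a, ∑ c, ∑ b, _ := Finset.sum_congr rfl fun a _ => Finset.sum_comm
    _ = _ := Finset.sum_comm

variable {X Z : Type*} [Fintype X] [Fintype Z] {p : X × Z → ℝ}

theorem mem_timeSharingWith_iff (hp : p ∈ stdSimplex ℝ (X × Z)) {U V Q : Type} [Fintype U]
    [Fintype V] [Fintype Q] {t : ℝ × ℝ × ℝ} :
    t ∈ timeSharingWith p U V Q ↔ ∃ (a : X → Q → U → ℝ) (b : Z → Q → V → ℝ) (r : Q → ℝ),
      (∀ x q, a x q ∈ stdSimplex ℝ U) ∧ (∀ z q, b z q ∈ stdSimplex ℝ V) ∧ r ∈ stdSimplex ℝ Q ∧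
      ∑ q, r q * ∑ u, rateTerm (fun x => ∑ z, p (x, z)) (fun x => a x q u) ≤ t.2.1 ∧
      ∑ q, r q * ∑ v, rateTerm (fun z => ∑ x, p (x, z)) (fun z => b z q v) ≤ t.2.2 ∧
      t.1 ≤ ∑ q, r q * ∑ u, infoTerm p (fun z => b z q) fun x => a x q u := by
  classical
  have key : ∀ (a : X → Q → U → ℝ) (b : Z → Q → V → ℝ) (r : Q → ℝ) (P : X × Z × U × V × Q → ℝ),
      (∀ x q, a x q ∈ stdSimplex ℝ U) → (∀ z q, b z q ∈ stdSimplex ℝ V) →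
      (∀ x z u v q, P (x, z, u, v, q) = p (x, z) * a x q u * b z q v * r q) →
      condMutInfo P (fun ω => ω.2.2.1) (fun ω => ω.1) (fun ω => ω.2.2.2.2) =
        ∑ q, r q * ∑ u, rateTerm (fun x => ∑ z, p (x, z)) (fun x => a x q u) ∧
      condMutInfo P (fun ω => ω.2.2.2.1) (fun ω => ω.2.1) (fun ω => ω.2.2.2.2) =
        ∑ q, r q * ∑ v, rateTerm (fun z => ∑ x, p (x, z)) (fun z => b z q v) ∧
      condMutInfo P (fun ω => ω.2.2.1) (fun ω => ω.2.2.2.1) (fun ω => ω.2.2.2.2) =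
        ∑ q, r q * ∑ u, infoTerm p (fun z => b z q) fun x => a x q u := by
    intro a b r P ha hb hP
    have hsum := fun q => (chanLaw_mem_stdSimplex hp (fun x => ha x q) fun z => hb z q).2
    refine ⟨?_, ?_, ?_⟩
    · rw [condMutInfo_eq_sum hsum (fun ω => ω.1) (fun ω => ω.2.1) (r := r)]
      · simp only [mutInfo_chanLaw_UX (fun x => ha x _) fun z => hb z _]
      · intro u x q
        rw [law_chanLaw_UX fun z => hb z q]
        simp only [law, Fintype.sum_prod_type, hP, Prod.mk.injEq, ite_and]
        simp [← Finset.mul_sum, ← Finset.sum_mul, (hb _ _).2]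
        ring
    · rw [condMutInfo_eq_sum hsum (fun ω => ω.2.2.2) (fun ω => ω.2.2.1) (r := r)]
      · simp only [mutInfo_chanLaw_VZ (fun x => ha x _) fun z => hb z _]
      · intro v z q
        rw [law_chanLaw_VZ fun x => ha x q]
        simp only [law, Fintype.sum_prod_type, hP, Prod.mk.injEq, ite_and]
        simp [← Finset.mul_sum, ← Finset.sum_mul, (ha _ _).2]
        ring
    · rw [condMutInfo_eq_sum hsum (fun ω => ω.1) (fun ω => ω.2.2.2) (r := r)]
      · simp only [mutInfo_chanLaw_UV fun x => ha x _]
      · intro u v q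
        rw [law_chanLaw_UV]
        simp only [law, Fintype.sum_prod_type, hP, Prod.mk.injEq, ite_and]
        simp [← Finset.sum_mul]
        ring
  constructor
  · rintro ⟨a, b, r, P, ha, hb, hr, hP, h1, h2, h3⟩
    obtain ⟨k1, k2, k3⟩ := key a b r P ha hb hP
    exact ⟨a, b, r, ha, hb, hr, k1 ▸ h1, k2 ▸ h2, k3 ▸ h3⟩
  · rintro ⟨a, b, r, ha, hb, hr, h1, h2, h3⟩
    obtain ⟨k1, k2, k3⟩ := key a b r (fun ω => p (ω.1, ω.2.1) * a ω.1 ω.2.2.2.2 ω.2.2.1 *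
      b ω.2.1 ω.2.2.2.2 ω.2.2.2.1 * r ω.2.2.2.2) ha hb fun _ _ _ _ _ => rfl
    exact ⟨a, b, r, _, ha, hb, hr, fun _ _ _ _ _ => rfl, k1.trans_le h1, k2.trans_le h2,
      h3.trans_eq k3.symm⟩

theorem timeSharingWith_subset (hp : p ∈ stdSimplex ℝ (X × Z)) (U V Q : Type) [Fintype U]
    [Fintype V] [Fintype Q] : timeSharingWith p U V Q ⊆ convexHull ℝ (innerWith p U V) := by
  intro t ht
  obtain ⟨a, b, r, ha, hb, hr, h1, h2, h3⟩ := (mem_timeSharingWith_iff hp).1 ht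
  set F : Q → ℝ := fun q => ∑ u, rateTerm (fun x => ∑ z, p (x, z)) fun x => a x q u
  set G : Q → ℝ := fun q => ∑ v, rateTerm (fun z => ∑ x, p (x, z)) fun z => b z q v
  set H : Q → ℝ := fun q => ∑ u, infoTerm p (fun z => b z q) fun x => a x q u
  -- The slack of t is added to the point of every q, so that the average is t itself.
  have hmem : ∑ q, r q • (H q + (t.1 - ∑ q, r q * H q), F q + (t.2.1 - ∑ q, r q * F q),
      G q + (t.2.2 - ∑ q, r q * G q)) ∈ convexHull ℝ (innerWith p U V) := by
    refine (convex_convexHull ℝ _).sum_mem (fun q _ => hr.1 q) hr.2 fun q _ => ?_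
    refine subset_convexHull ℝ _ ((mem_innerWith_iff hp).2 ⟨fun x => a x q, fun z => b z q,
      fun x => ha x q, fun z => hb z q, ?_, ?_, ?_⟩)
    · exact le_add_of_nonneg_right (sub_nonneg.2 h1)
    · exact le_add_of_nonneg_right (sub_nonneg.2 h2)
    · exact add_le_of_nonpos_right (sub_nonpos.2 h3)
  convert hmem using 1
  refine Prod.ext ?_ (Prod.ext ?_ ?_) <;>
    simp only [Prod.fst_sum, Prod.snd_sum, Prod.smul_fst, Prod.smul_snd, smul_eq_mul, mul_add,
      Finset.sum_add_distrib, ← Finset.sum_mul, hr.2] <;> ring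

theorem exists_three_point_combination {S : Set (ℝ × ℝ × ℝ)} {t : ℝ × ℝ × ℝ}
    (ht : t ∈ convexHull ℝ S) :
    ∃ m ≤ 3, ∃ (r : Fin m → ℝ) (s : Fin m → ℝ × ℝ × ℝ), r ∈ stdSimplex ℝ (Fin m) ∧
      (∀ q, s q ∈ S) ∧ ∑ q, r q * (s q).2.1 = t.2.1 ∧ ∑ q, r q * (s q).2.2 = t.2.2 ∧
      t.1 ≤ ∑ q, r q * (s q).1 := by
  classical
  obtain ⟨ι, _, w, z, hw0, hw1, hz, hsum⟩ := mem_convexHull_iff_exists_fintype.1 ht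
  -- The constraints fix the mass and the two rates. The linear functional μ is at least its
  -- original value at one of the small-support weightings, which saves one point over Carathéodory
  -- in dimension three.
  let A : Fin 3 → ι → ℝ := ![fun _ => 1, fun i => (z i).2.1, fun i => (z i).2.2]
  have hmem := mem_convexHull_small_support A ![1, 0, 0] hw0 fun i _ => by
    simp [Fin.sum_univ_three, A]
  obtain ⟨v, ⟨hv0, hv1, hv2⟩, hle⟩ :=
    ((Fintype.linearCombination ℝ fun i => (z i).1).convexOn convex_univ).exists_ge_of_mem_convexHull
      (Set.subset_univ _) hmem
  have e := Finset.equivFin (Finset.univ.filter fun i => v i ≠ 0)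
  have hS : ∀ g : ι → ℝ, ∑ q, v (e.symm q) * g (e.symm q) = ∑ i, v i * g i := by
    intro g
    rw [Equiv.sum_comp e.symm fun i : {i // i ∈ Finset.univ.filter fun i => v i ≠ 0} => v i * g i]
    refine Fintype.sum_of_injective Subtype.val Subtype.val_injective _ _ (fun i hi => ?_)
      fun _ => rfl
    have : v i = 0 := by
      by_contra h
      exact hi ⟨⟨i, by simpa using h⟩, rfl⟩
    rw [this, zero_mul]
  refine ⟨_, hv2.trans_eq (Fintype.card_fin 3), fun q => v (e.symm q), fun q => z (e.symm q),
    ⟨fun q => hv0 _, ?_⟩, fun q => hz _, ?_, ?_, ?_⟩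
  · have h0 := hv1 0
    simp only [A, Matrix.cons_val_zero, one_mul] at h0
    have := hS fun _ => 1
    simp only [mul_one] at this
    rw [this, h0, hw1]
  · rw [hS fun i => (z i).2.1]
    have h1 := hv1 1
    simp only [A, Matrix.cons_val_one, Matrix.cons_val_zero, mul_comm (z _).2.1] at h1
    rw [h1, ← hsum]
    simp [Prod.fst_sum, Prod.snd_sum]
  · rw [hS fun i => (z i).2.2]
    have h2 := hv1 2
    simp only [A, Matrix.cons_val, mul_comm (z _).2.2] at h2
    rw [h2, ← hsum]
    simp [Prod.snd_sum]
  · rw [hS fun i => (z i).1, ← hsum]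
    simp only [Fintype.linearCombination_apply, smul_eq_mul] at hle
    simpa [Prod.fst_sum] using hle

theorem convexHull_innerRegionBounded_eq_timeSharingRegion (hp : p ∈ stdSimplex ℝ (X × Z)) :
    convexHull ℝ (innerRegionBounded p) = timeSharingRegion p := by
  refine Set.Subset.antisymm (fun t ht => ?_) ?_
  · rw [innerRegionBounded_eq hp] at ht
    obtain ⟨m, hm, r, s, hr, hs, h1, h2, h3⟩ := exists_three_point_combination ht
    choose a b ha hb hF hG hH using fun q => (mem_innerWith_iff hp).1 (hs q)
    refine ⟨Fintype.card X, Fintype.card Z, m, le_rfl, le_rfl, hm, ?_⟩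
    refine (mem_timeSharingWith_iff hp).2
      ⟨fun x q => a q x, fun z q => b q z, r, fun x q => ha q x, fun z q => hb q z, hr, ?_, ?_, ?_⟩
    · rw [← h1]
      exact Finset.sum_le_sum fun q _ => mul_le_mul_of_nonneg_left (hF q) (hr.1 q)
    · rw [← h2]
      exact Finset.sum_le_sum fun q _ => mul_le_mul_of_nonneg_left (hG q) (hr.1 q)
    · exact h3.trans (Finset.sum_le_sum fun q _ => mul_le_mul_of_nonneg_left (hH q) (hr.1 q))
  · rintro t ⟨k, l, m, hk, hl, -, ht⟩
    have hsub : innerWith p (Fin k) (Fin l) ⊆ innerRegionBounded p := fun s hs => ⟨k, l, hk, hl, hs⟩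
    exact convexHull_mono hsub (timeSharingWith_subset hp _ _ _ ht)

end TimeSharing

end Biclustering
end

theorem mainTheorem7 {X Z : Type*} [Fintype X] [Fintype Z]
    (p : X × Z → ℝ) (hp : p ∈ stdSimplex ℝ (X × Z)) :
    convexHull ℝ (Biclustering.innerRegionBounded p) = convexHull ℝ (Biclustering.innerRegion p) ∧
    convexHull ℝ (Biclustering.innerRegion p) ⊆ closure (Biclustering.achievable p) ∧
    convexHull ℝ (Biclustering.innerRegionBounded p) = Biclustering.timeSharingRegion p :=
  ⟨Biclustering.convexHull_innerRegionBounded hp, Biclustering.convexHull_innerRegion_subset hp,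
    Biclustering.convexHull_innerRegionBounded_eq_timeSharingRegion hp⟩
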